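/- Let $K$ be a field, $\mathscr X$ a small category and $\mathcal C:\mathscr X\to Coalg_K$ a functor to $K$-coalgebras such that every $\mathcal C_x$ is cocommutative. Write $\mathbf M^{C}$ for the category of right $C$-comodules and $\mathbf M_{[C,-]}$ for the category of right $C$-contramodules (spaces $M$ with a contraassociative, counital map $\pi_M:Hom_K(C,M)\to M$). For a coalgebra map $\alpha:C\to D$ let $\alpha^*:\mathbf M^C\to\mathbf M^D$ be corestriction, with coaction $(id\otimes\alpha)\rho$, and let $\alpha_\bullet:\mathbf M_{[C,-]}\to\mathbf M_{[D,-]}$ be contrarestriction, with contraaction $f\mapsto\pi(f\circ\alpha)$. A trans-comodule $\mathcal M\in Com^{tr}\text{-}\mathcal C$ consists of $\mathcal M_x\in\mathbf M^{\mathcal C_x}$ and morphisms ${}_\alpha\mathcal M:\mathcal M_y\to\alpha^*\mathcal M_x$ in $\mathbf M^{\mathcal C_y}$ for all $\alpha:x\to y$, with ${}_{id}\mathcal M=id$ and ${}_{\beta\alpha}\mathcal M=\beta^*({}_\alpha\mathcal M)\circ{}_\beta\mathcal M$. A trans-contramodule $\mathcal M\in Cont^{tr}\text{-}\mathcal C$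 is defined in the same way, with $\mathcal M_x\in\mathbf M_{[\mathcal C_x,-]}$ and morphisms ${}_\alpha\mathcal M:\mathcal M_y\to\alpha_\bullet\mathcal M_x$. Morphisms are families of morphisms $(\eta_x)_x$ that commute with the structure maps. A right comodule $M$ over $C$ is quasi-finite if $-\otimes M:Vect\to\mathbf M^C$ has a left adjoint $H_C(M,-)$. The representation $\mathcal C$ is quasi-finite if each $\mathcal C_\alpha:\mathcal C_x\to\mathcal C_y$ makes $\mathcal C_x$ a quasi-finite right $\mathcal C_y$-comodule; then $\alpha^*$ has the left adjoint $\alpha^!=H_{\mathcal C_y}(\mathcal C_x,-)$, and a trans-comodule $\mathcal N$ is cartesian if for every $\alpha:x\to y$ the morphism ${}^\alpha\mathcal N:\alpha^!\mathcal N_y\to\mathcal N_x$ that corresponds to ${}_\alpha\mathcal N$ is an isomorphism. For a cocommutative coalgebra $C$, $M\in\mathbf M_{[C,-]}$ and $N\in\mathbf M^C$, the contratensor product $M\boxtimes_CN\in\mathbf M^C$ is the coequalizer of the two maps $Hom_K(C,M)\otimes N\rightrightarrows M\otimes N$ induced by $\pi_M$ and by $N\to C\otimes N$, with the coaction induced by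 that of $N$. For $N,P\in\mathbf M^C$, the space $\mathbf M^C(N,P)$ is a right $C$-contramodule by $\pi(f)(n)=f(n_{(1)})(n_{(0)})$. Let $\mathcal N$ be a trans-comodule over $\mathcal C$. (a) There is a functor $F:Cont^{tr}\text{-}\mathcal C\to Com^{tr}\text{-}\mathcal C$ with $F(\mathcal M)_x=\mathcal M_x\boxtimes_{\mathcal C_x}\mathcal N_x$ for all $x$, whose structure map at $\alpha:y\to x$ sends the class of $m\otimes n$ to the class of ${}_\alpha\mathcal M(m)\otimes{}_\alpha\mathcal N(n)$, and with $F(\varphi)_x=\varphi_x\boxtimes id$. (b) Suppose that $\mathcal C$ is quasi-finite and that $\mathcal N$ is cartesian. Then there is a functor $G:Com^{tr}\text{-}\mathcal C\to Cont^{tr}\text{-}\mathcal C$ with $G(\mathcal P)_x=\mathbf M^{\mathcal C_x}(\mathcal N_x,\mathcal P_x)$ for all $x$, whose structure map at $\alpha:y\to x$ sends $\varphi:\mathcal N_x\to\mathcal P_x$ to ${}^\alpha\mathcal P\circ\alpha^!(\varphi)\circ({}^\alpha\mathcal N)^{-1}:\mathcal N_y\to\mathcal P_y$, and with $G(\psi)_x=\psi_x\circ-$.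 Moreover, $F$ is left adjoint to $G$. -/

import Mathlib

open CategoryTheory
open scoped TensorProduct

universe u w₁ w₂

/-! ### Right comodules -/

/-- A right comodule over a `K`-coalgebra `C`: a vector space with a coassociative and counital
coaction `ρ : M → M ⊗ C`. -/
structure RightComodule (K : Type u) [Field K] (C : Type u) [AddCommGroup C] [Module K C]
    [Coalgebra K C] where
  carrier : Type u
  [addCommGroup : AddCommGroup carrier]
  [module : Module K carrier]
  coact : carrier →ₗ[K] carrier ⊗[K] C
  coassoc : (TensorProduct.assoc K carrier C C).toLinearMap ∘ₗ coact.rTensor C ∘ₗ coact =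
    (Coalgebra.comul (R := K) (A := C)).lTensor carrier ∘ₗ coact
  rid_counit : (TensorProduct.rid K carrier).toLinearMap ∘ₗ
    (Coalgebra.counit (R := K) (A := C)).lTensor carrier ∘ₗ coact = LinearMap.id

attribute [instance] RightComodule.addCommGroup RightComodule.module

namespace RightComodule

variable {K : Type u} [Field K]
variable {C : Type u} [AddCommGroup C] [Module K C] [Coalgebra K C]
variable {D : Type u} [AddCommGroup D] [Module K D] [Coalgebra K D]

/-- The subspace of `Hom_K(M, N)` formed by the morphisms of right `C`-comodules. -/
def homs (M N : RightComodule K C) : Submodule K (M.carrier →ₗ[K] N.carrier) where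
  carrier := {f | N.coact ∘ₗ f = f.rTensor C ∘ₗ M.coact}
  add_mem' {f g} hf hg := by
    simp only [Set.mem_ofPred_eq] at *
    rw [LinearMap.comp_add, hf, hg, LinearMap.rTensor_add, LinearMap.add_comp]
  zero_mem' := by simp
  smul_mem' c f hf := by
    simp only [Set.mem_ofPred_eq] at *
    rw [LinearMap.comp_smul, hf, LinearMap.rTensor_smul, LinearMap.smul_comp]

/-- A morphism of right comodules: a linear map that commutes with the coactions. -/
@[ext]
structure Hom (M N : RightComodule K C) where
  lin : M.carrier →ₗ[K] N.carrier
  mem : lin ∈ homs M N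

/-- The category `M^C` of right `C`-comodules. -/
instance : Category (RightComodule K C) where
  Hom M N := Hom M N
  id M := ⟨LinearMap.id, by simp [homs]⟩
  comp {M N P} f g := ⟨g.lin ∘ₗ f.lin, by
    have hf : N.coact ∘ₗ f.lin = f.lin.rTensor C ∘ₗ M.coact := f.mem
    have hg : P.coact ∘ₗ g.lin = g.lin.rTensor C ∘ₗ N.coact := g.mem
    change P.coact ∘ₗ (g.lin ∘ₗ f.lin) = (g.lin ∘ₗ f.lin).rTensor C ∘ₗ M.coact
    rw [← LinearMap.comp_assoc, hg, LinearMap.comp_assoc, hf, LinearMap.rTensor_comp,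
      LinearMap.comp_assoc]⟩

/-- The underlying linear map of a morphism of comodules. -/
def linMap {M N : RightComodule K C} (f : M ⟶ N) : M.carrier →ₗ[K] N.carrier := Hom.lin f

@[ext]
theorem hom_ext {M N : RightComodule K C} {f g : M ⟶ N} (h : linMap f = linMap g) : f = g :=
  Hom.ext h

@[simp] theorem linMap_id (M : RightComodule K C) : linMap (𝟙 M) = LinearMap.id := rfl

@[simp] theorem linMap_comp {M N P : RightComodule K C} (f : M ⟶ N) (g : N ⟶ P) :
    linMap (f ≫ g) = linMap g ∘ₗ linMap f := rfl

theorem linMap_comm {M N : RightComodule K C} (f : M ⟶ N) :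
    N.coact ∘ₗ linMap f = (linMap f).rTensor C ∘ₗ M.coact := Hom.mem f

/-- An element of the space `homs M N`, regarded as a morphism of comodules. -/
def ofHoms {M N : RightComodule K C} (f : homs M N) : M ⟶ N := Hom.mk f.1 f.2

variable (K C) in
/-- The coalgebra `C` as a right comodule over itself. -/
def regular : RightComodule K C where
  carrier := C
  coact := Coalgebra.comul
  coassoc := Coalgebra.coassoc
  rid_counit := by
    ext c
    simp

/-- The corestriction `α^* M` of a right `C`-comodule along a morphism `α : C → D` of coalgebras:
the coaction is `(id ⊗ α) ∘ ρ`. -/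
def corestrictObj (α : C →ₗc[K] D) (M : RightComodule K C) : RightComodule K D where
  carrier := M.carrier
  coact := α.toLinearMap.lTensor M.carrier ∘ₗ M.coact
  coassoc := by
    have h1 : (TensorProduct.assoc K M.carrier D D).toLinearMap ∘ₗ
        (α.toLinearMap.lTensor M.carrier ∘ₗ M.coact).rTensor D ∘ₗ
          α.toLinearMap.lTensor M.carrier =
        (TensorProduct.map α.toLinearMap α.toLinearMap).lTensor M.carrier ∘ₗ
          (TensorProduct.assoc K M.carrier C C).toLinearMap ∘ₗ M.coact.rTensor C := by
      ext m c
      simp only [TensorProduct.AlgebraTensorModule.curry_apply, LinearMap.restrictScalars_self,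
        TensorProduct.curry_apply, LinearMap.comp_apply, LinearMap.lTensor_tmul,
        LinearMap.rTensor_tmul, LinearEquiv.coe_coe]
      induction M.coact m using TensorProduct.induction_on with
      | zero => simp
      | tmul a b => simp
      | add a b ha hb => simp only [map_add, TensorProduct.add_tmul, ha, hb]
    have h2 : (TensorProduct.map α.toLinearMap α.toLinearMap) ∘ₗ
        Coalgebra.comul (R := K) (A := C) = Coalgebra.comul ∘ₗ α.toLinearMap :=
      α.map_comp_comul
    ext m
    have e1 := LinearMap.congr_fun h1 (M.coact m)
    have e2 := LinearMap.congr_fun M.coassoc m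
    simp only [LinearMap.comp_apply] at e1 e2 ⊢
    rw [e1, e2, ← LinearMap.lTensor_comp_apply, h2, LinearMap.lTensor_comp_apply]
  rid_counit := by
    have h : Coalgebra.counit (R := K) (A := D) ∘ₗ α.toLinearMap = Coalgebra.counit :=
      α.counit_comp
    ext m
    have e := LinearMap.congr_fun M.rid_counit m
    simp only [LinearMap.comp_apply] at e ⊢
    rw [← LinearMap.lTensor_comp_apply, h, e]

/-- The corestriction functor `α^* : M^C ⥤ M^D` along a morphism `α : C → D` of coalgebras. -/
def corestrict (α : C →ₗc[K] D) : RightComodule K C ⥤ RightComodule K D where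
  obj M := corestrictObj α M
  map {M N} f := Hom.mk (M := corestrictObj α M) (N := corestrictObj α N) (linMap f :) (by
    change (α.toLinearMap.lTensor N.carrier ∘ₗ N.coact) ∘ₗ linMap f =
      (linMap f).rTensor D ∘ₗ (α.toLinearMap.lTensor M.carrier ∘ₗ M.coact)
    rw [LinearMap.comp_assoc, linMap_comm, ← LinearMap.comp_assoc, ← LinearMap.comp_assoc,
      LinearMap.lTensor_comp_rTensor, LinearMap.rTensor_comp_lTensor])

/-- The comodule `V ⊗ M`, on which `C` coacts through `M`. -/
def tensorObj (V : Type u) [AddCommGroup V] [Module K V] (M : RightComodule K C) :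
    RightComodule K C where
  carrier := V ⊗[K] M.carrier
  coact := (TensorProduct.assoc K V M.carrier C).symm.toLinearMap ∘ₗ M.coact.lTensor V
  coassoc := by
    ext v m
    have e := LinearMap.congr_fun M.coassoc m
    simp only [TensorProduct.AlgebraTensorModule.curry_apply, LinearMap.restrictScalars_self,
      TensorProduct.curry_apply, LinearMap.comp_apply, LinearMap.lTensor_tmul,
      LinearEquiv.coe_coe] at e ⊢
    have h1 : ∀ t : M.carrier ⊗[K] C,
        TensorProduct.assoc K (V ⊗[K] M.carrier) C C
          ((((TensorProduct.assoc K V M.carrier C).symm.toLinearMap ∘ₗ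
            M.coact.lTensor V).rTensor C) ((TensorProduct.assoc K V M.carrier C).symm (v ⊗ₜ t))) =
        (TensorProduct.assoc K V M.carrier (C ⊗[K] C)).symm
          (v ⊗ₜ TensorProduct.assoc K M.carrier C C (M.coact.rTensor C t)) := by
      intro t
      induction t using TensorProduct.induction_on with
      | zero => simp
      | add a b ha hb => simp only [map_add, TensorProduct.tmul_add, ha, hb]
      | tmul n c =>
        simp only [TensorProduct.assoc_symm_tmul, LinearMap.rTensor_tmul, LinearMap.comp_apply,
          LinearMap.lTensor_tmul, LinearEquiv.coe_coe]
        induction M.coact n using TensorProduct.induction_on with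
        | zero => simp
        | add a b ha hb => simp only [map_add, TensorProduct.add_tmul, TensorProduct.tmul_add, ha, hb]
        | tmul n c => simp
    have h2 : ∀ t : M.carrier ⊗[K] C,
        (Coalgebra.comul (R := K) (A := C)).lTensor (V ⊗[K] M.carrier)
          ((TensorProduct.assoc K V M.carrier C).symm (v ⊗ₜ t)) =
        (TensorProduct.assoc K V M.carrier (C ⊗[K] C)).symm
          (v ⊗ₜ (Coalgebra.comul (R := K) (A := C)).lTensor M.carrier t) := by
      intro t
      induction t using TensorProduct.induction_on with
      | zero => simp
      | add a b ha hb => simp only [map_add, TensorProduct.tmul_add, ha, hb]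
      | tmul n c => simp
    rw [h1, h2, e]
  rid_counit := by
    ext v m
    have e := LinearMap.congr_fun M.rid_counit m
    simp only [TensorProduct.AlgebraTensorModule.curry_apply, LinearMap.restrictScalars_self,
      TensorProduct.curry_apply, LinearMap.comp_apply, LinearMap.lTensor_tmul,
      LinearEquiv.coe_coe, LinearMap.id_apply] at e ⊢
    have h : ∀ t : M.carrier ⊗[K] C,
        TensorProduct.rid K (V ⊗[K] M.carrier)
          ((Coalgebra.counit (R := K) (A := C)).lTensor (V ⊗[K] M.carrier)
            ((TensorProduct.assoc K V M.carrier C).symm (v ⊗ₜ t))) =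
        v ⊗ₜ TensorProduct.rid K M.carrier
          ((Coalgebra.counit (R := K) (A := C)).lTensor M.carrier t) := by
      intro t
      induction t using TensorProduct.induction_on with
      | zero => simp
      | add a b ha hb => simp only [map_add, TensorProduct.tmul_add, ha, hb]
      | tmul n c => simp
    rw [h, e]

/-- The functor `- ⊗ M : Vect ⥤ M^C`. -/
def tensorFunctor (M : RightComodule K C) : ModuleCat.{u} K ⥤ RightComodule K C where
  obj V := tensorObj V M
  map {V W} f := Hom.mk (M := tensorObj V M) (N := tensorObj W M) (f.hom.rTensor M.carrier) (by
    change ((TensorProduct.assoc K W M.carrier C).symm.toLinearMap ∘ₗ M.coact.lTensor W) ∘ₗ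
        f.hom.rTensor M.carrier = (f.hom.rTensor M.carrier).rTensor C ∘ₗ
        ((TensorProduct.assoc K V M.carrier C).symm.toLinearMap ∘ₗ M.coact.lTensor V)
    ext v m
    simp only [TensorProduct.AlgebraTensorModule.curry_apply, LinearMap.restrictScalars_self,
      TensorProduct.curry_apply, LinearMap.comp_apply, LinearMap.lTensor_tmul,
      LinearMap.rTensor_tmul, LinearEquiv.coe_coe]
    induction M.coact m using TensorProduct.induction_on with
    | zero => simp
    | add a b ha hb => simp only [map_add, TensorProduct.tmul_add, ha, hb]
    | tmul n c => simp)
  map_id V := by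
    apply hom_ext
    change (LinearMap.id : V →ₗ[K] V).rTensor M.carrier = LinearMap.id
    simp
  map_comp f g := by
    apply hom_ext
    change (g.hom ∘ₗ f.hom).rTensor M.carrier = g.hom.rTensor _ ∘ₗ f.hom.rTensor _
    rw [LinearMap.rTensor_comp]

/-- A right comodule `M` is quasi-finite if the functor `- ⊗ M : Vect ⥤ M^C` has a left adjoint. -/
class IsQuasiFinite (M : RightComodule K C) : Prop where
  isRightAdjoint : (tensorFunctor M).IsRightAdjoint

attribute [instance] IsQuasiFinite.isRightAdjoint

/-- The functor `H_C(M, -) : M^C ⥤ Vect` of a quasi-finite comodule `M`, which is left adjoint to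
`- ⊗ M`. -/
noncomputable def cohom (M : RightComodule K C) [IsQuasiFinite M] :
    RightComodule K C ⥤ ModuleCat.{u} K := (tensorFunctor M).leftAdjoint

/-- The adjunction between `H_C(M, -)` and `- ⊗ M`. -/
noncomputable def cohomAdj (M : RightComodule K C) [IsQuasiFinite M] :
    cohom M ⊣ tensorFunctor M := Adjunction.ofIsRightAdjoint _

/-- The unit `M → H_C(N, M) ⊗ N` of the adjunction, as a linear map. -/
noncomputable def cohomUnit (N : RightComodule K C) [IsQuasiFinite N] (M : RightComodule K C) :
    M.carrier →ₗ[K] (cohom N).obj M ⊗[K] N.carrier :=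
  linMap ((cohomAdj N).unit.app M)

/-- The linear map `H_C(N, M) → V` that corresponds to a morphism `M → V ⊗ N` of comodules. -/
noncomputable def cohomDesc {N : RightComodule K C} [IsQuasiFinite N] {M : RightComodule K C}
    {V : Type u} [AddCommGroup V] [Module K V] (k : M ⟶ tensorObj V N) :
    (cohom N).obj M →ₗ[K] V :=
  (((cohomAdj N).homEquiv M (ModuleCat.of K V)).symm k).hom

theorem cohomDesc_unit {N : RightComodule K C} [IsQuasiFinite N] {M : RightComodule K C}
    {V : Type u} [AddCommGroup V] [Module K V] (k : M ⟶ tensorObj V N) :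
    (cohomDesc k).rTensor N.carrier ∘ₗ cohomUnit N M = linMap k := by
  have h := ((cohomAdj N).homEquiv M (ModuleCat.of K V)).apply_symm_apply k
  rw [Adjunction.homEquiv_unit] at h
  exact congrArg linMap h

theorem cohom_hom_ext {N : RightComodule K C} [IsQuasiFinite N] {M : RightComodule K C}
    {V : Type u} [AddCommGroup V] [Module K V] {f g : (cohom N).obj M →ₗ[K] V}
    (h : f.rTensor N.carrier ∘ₗ cohomUnit N M = g.rTensor N.carrier ∘ₗ cohomUnit N M) :
    f = g := by
  have : ModuleCat.ofHom f = ModuleCat.ofHom g := by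
    apply ((cohomAdj N).homEquiv M (ModuleCat.of K V)).injective
    rw [Adjunction.homEquiv_unit, Adjunction.homEquiv_unit]
    apply hom_ext
    exact h
  exact congrArg ModuleCat.Hom.hom this

/-- A morphism of coalgebras `α : C → D` is quasi-finite if it makes `C` a quasi-finite right
`D`-comodule. -/
abbrev IsQuasiFiniteHom (α : C →ₗc[K] D) : Prop := IsQuasiFinite (corestrictObj α (regular K C))

section tensorLemmas

variable (C) (H : Type u) [AddCommGroup H] [Module K H]

/-- The map `id ⊗ Δ : H ⊗ C → (H ⊗ C) ⊗ C`. -/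
def tensorComul : H ⊗[K] C →ₗ[K] (H ⊗[K] C) ⊗[K] C :=
  (TensorProduct.assoc K H C C).symm.toLinearMap ∘ₗ Coalgebra.comul.lTensor H

/-- The map `id ⊗ ε : H ⊗ C → H`. -/
def tensorCounit : H ⊗[K] C →ₗ[K] H :=
  (TensorProduct.rid K H).toLinearMap ∘ₗ (Coalgebra.counit (R := K) (A := C)).lTensor H

variable {C H} {V : Type u} [AddCommGroup V] [Module K V]

theorem tensorComul_natural (f : H →ₗ[K] V) (t : H ⊗[K] C) :
    (f.rTensor C).rTensor C (tensorComul C H t) = tensorComul C V (f.rTensor C t) := by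
  induction t using TensorProduct.induction_on with
  | zero => simp
  | add a b ha hb => simp only [map_add, ha, hb]
  | tmul x c =>
    simp only [tensorComul, LinearMap.comp_apply, LinearMap.lTensor_tmul, LinearEquiv.coe_coe,
      LinearMap.rTensor_tmul]
    induction Coalgebra.comul (R := K) c using TensorProduct.induction_on with
    | zero => simp
    | add a b ha hb => simp only [map_add, TensorProduct.tmul_add, ha, hb]
    | tmul a b => simp

theorem tensorCounit_natural (f : H →ₗ[K] V) (t : H ⊗[K] C) :
    tensorCounit C V (f.rTensor C t) = f (tensorCounit C H t) := by
  induction t using TensorProduct.induction_on with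
  | zero => simp
  | add a b ha hb => simp only [map_add, ha, hb]
  | tmul x c => simp [tensorCounit]

theorem tensorComul_coassoc (t : H ⊗[K] C) :
    tensorComul C (H ⊗[K] C) (tensorComul C H t) =
      (tensorComul C H).rTensor C (tensorComul C H t) := by
  induction t using TensorProduct.induction_on with
  | zero => simp
  | add a b ha hb => simp only [map_add, ha, hb]
  | tmul x c =>
    let Φ : C ⊗[K] (C ⊗[K] C) →ₗ[K] ((H ⊗[K] C) ⊗[K] C) ⊗[K] C :=
      (TensorProduct.assoc K (H ⊗[K] C) C C).symm.toLinearMap ∘ₗ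
        (TensorProduct.mk K H C x).rTensor (C ⊗[K] C)
    have h1 : ∀ s : C ⊗[K] C, tensorComul C (H ⊗[K] C)
        ((TensorProduct.assoc K H C C).symm (x ⊗ₜ s)) = Φ (Coalgebra.comul.lTensor C s) := by
      intro s
      induction s using TensorProduct.induction_on with
      | zero => simp
      | add a b ha hb => simp only [map_add, TensorProduct.tmul_add, ha, hb]
      | tmul a b => simp [tensorComul, Φ]
    have h2 : ∀ s : C ⊗[K] C, (tensorComul C H).rTensor C
        ((TensorProduct.assoc K H C C).symm (x ⊗ₜ s)) =
          Φ (TensorProduct.assoc K C C C (Coalgebra.comul.rTensor C s)) := by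
      intro s
      induction s using TensorProduct.induction_on with
      | zero => simp
      | add a b ha hb => simp only [map_add, TensorProduct.tmul_add, ha, hb]
      | tmul a b =>
        simp only [tensorComul, LinearMap.comp_apply, LinearMap.lTensor_tmul, LinearEquiv.coe_coe,
          LinearMap.rTensor_tmul, TensorProduct.assoc_symm_tmul]
        induction Coalgebra.comul (R := K) a using TensorProduct.induction_on with
        | zero => simp
        | add a b ha hb =>
          simp only [map_add, TensorProduct.tmul_add, TensorProduct.add_tmul, ha, hb]
        | tmul a b => simp [Φ]
    have h3 : tensorComul C H (x ⊗ₜ[K] c) =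
        (TensorProduct.assoc K H C C).symm (x ⊗ₜ Coalgebra.comul c) := by
      simp [tensorComul]
    rw [h3, h1, h2, Coalgebra.coassoc_apply]

theorem tensorCounit_tensorComul (t : H ⊗[K] C) :
    tensorCounit C (H ⊗[K] C) (tensorComul C H t) = t := by
  induction t using TensorProduct.induction_on with
  | zero => simp
  | add a b ha hb => simp only [map_add, ha, hb]
  | tmul x c =>
    have h : ∀ s : C ⊗[K] C, tensorCounit C (H ⊗[K] C)
        ((TensorProduct.assoc K H C C).symm (x ⊗ₜ s)) =
          x ⊗ₜ TensorProduct.rid K C (Coalgebra.counit.lTensor C s) := by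
      intro s
      induction s using TensorProduct.induction_on with
      | zero => simp
      | add a b ha hb => simp only [map_add, TensorProduct.tmul_add, ha, hb]
      | tmul a b => simp [tensorCounit]
    have h3 : tensorComul C H (x ⊗ₜ[K] c) =
        (TensorProduct.assoc K H C C).symm (x ⊗ₜ Coalgebra.comul c) := by
      simp [tensorComul]
    rw [h3, h, Coalgebra.lTensor_counit_comul]
    simp

theorem tensorCounit_rTensor_tensorComul (t : H ⊗[K] C) :
    (tensorCounit C H).rTensor C (tensorComul C H t) = t := by
  induction t using TensorProduct.induction_on with
  | zero => simp
  | add a b ha hb => simp only [map_add, ha, hb]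
  | tmul x c =>
    have h : ∀ s : C ⊗[K] C, (tensorCounit C H).rTensor C
        ((TensorProduct.assoc K H C C).symm (x ⊗ₜ s)) =
          x ⊗ₜ TensorProduct.lid K C (Coalgebra.counit.rTensor C s) := by
      intro s
      induction s using TensorProduct.induction_on with
      | zero => simp
      | add a b ha hb => simp only [map_add, TensorProduct.tmul_add, ha, hb]
      | tmul a b => simp [tensorCounit, TensorProduct.smul_tmul]
    have h3 : tensorComul C H (x ⊗ₜ[K] c) =
        (TensorProduct.assoc K H C C).symm (x ⊗ₜ Coalgebra.comul c) := by
      simp [tensorComul]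
    rw [h3, h, Coalgebra.rTensor_counit_comul]
    simp

theorem coact_rTensor_coact (W : RightComodule K C) (w : W.carrier) :
    W.coact.rTensor C (W.coact w) = tensorComul C W.carrier (W.coact w) := by
  have h := LinearMap.congr_fun W.coassoc w
  simp only [LinearMap.comp_apply, LinearEquiv.coe_coe] at h
  simp only [tensorComul, LinearMap.comp_apply, LinearEquiv.coe_coe]
  rw [← h, LinearEquiv.symm_apply_apply]

theorem tensorCounit_coact (W : RightComodule K C) (w : W.carrier) :
    tensorCounit C W.carrier (W.coact w) = w :=
  LinearMap.congr_fun W.rid_counit w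

theorem tensorObj_regular_coact (α : C →ₗc[K] D) (t : H ⊗[K] C) :
    (tensorObj H (corestrictObj α (regular K C))).coact t =
      α.toLinearMap.lTensor (H ⊗[K] C) (tensorComul C H t) := by
  change (TensorProduct.assoc K H C D).symm
    ((α.toLinearMap.lTensor C ∘ₗ Coalgebra.comul).lTensor H t) = _
  induction t using TensorProduct.induction_on with
  | zero => simp
  | add a b ha hb => simp only [map_add, ha, hb]
  | tmul x c =>
    simp only [tensorComul, LinearMap.comp_apply, LinearMap.lTensor_tmul, LinearEquiv.coe_coe]
    induction Coalgebra.comul (R := K) c using TensorProduct.induction_on with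
    | zero => simp
    | add a b ha hb => simp only [map_add, TensorProduct.tmul_add, ha, hb]
    | tmul a b => simp

theorem lTensor_rTensor_swap {A B : Type u} [AddCommGroup A] [Module K A] [AddCommGroup B]
    [Module K B] (h : A →ₗ[K] B) (f : H →ₗ[K] V) (t : H ⊗[K] A) :
    h.lTensor V (f.rTensor A t) = f.rTensor B (h.lTensor H t) := by
  rw [← LinearMap.comp_apply, ← LinearMap.comp_apply, LinearMap.lTensor_comp_rTensor,
    LinearMap.rTensor_comp_lTensor]

end tensorLemmas

section shriek

variable (α : C →ₗc[K] D) [IsQuasiFiniteHom α] (M : RightComodule K D)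

/-- The vector space `H_D(C, M)`. -/
noncomputable abbrev shriekCarrier : Type u := (cohom (corestrictObj α (regular K C))).obj M

/-- The unit `M → H_D(C, M) ⊗ C`. -/
noncomputable def shriekUnit : M.carrier →ₗ[K] shriekCarrier α M ⊗[K] C :=
  cohomUnit (corestrictObj α (regular K C)) M

variable {α M} in
theorem shriek_hom_ext {V : Type u} [AddCommGroup V] [Module K V]
    {f g : shriekCarrier α M →ₗ[K] V}
    (h : f.rTensor C ∘ₗ shriekUnit α M = g.rTensor C ∘ₗ shriekUnit α M) : f = g :=
  cohom_hom_ext h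

/-- The unit is a morphism of `D`-comodules. -/
theorem shriekUnit_comm (m : M.carrier) :
    (shriekUnit α M).rTensor D (M.coact m) =
      α.toLinearMap.lTensor (shriekCarrier α M ⊗[K] C)
        (tensorComul C (shriekCarrier α M) (shriekUnit α M m)) := by
  rw [← tensorObj_regular_coact]
  exact (LinearMap.congr_fun
    (linMap_comm ((cohomAdj (corestrictObj α (regular K C))).unit.app M)) m).symm

/-- The map `(id ⊗ Δ) ∘ unit : M → (H_D(C, M) ⊗ C) ⊗ C`, as a morphism of `D`-comodules. -/
noncomputable def shriekAux :
    M ⟶ tensorObj (shriekCarrier α M ⊗[K] C) (corestrictObj α (regular K C)) :=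
  Hom.mk (M := M) (N := tensorObj (shriekCarrier α M ⊗[K] C) (corestrictObj α (regular K C)))
    (tensorComul C (shriekCarrier α M) ∘ₗ shriekUnit α M) (by
      ext m
      change (tensorObj (shriekCarrier α M ⊗[K] C) (corestrictObj α (regular K C))).coact
        (tensorComul C (shriekCarrier α M) (shriekUnit α M m)) =
          (tensorComul C (shriekCarrier α M) ∘ₗ shriekUnit α M).rTensor D (M.coact m)
      rw [LinearMap.rTensor_comp_apply, shriekUnit_comm, ← lTensor_rTensor_swap,
        ← tensorComul_coassoc]
      exact tensorObj_regular_coact α _)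

/-- The right `C`-coaction of `H_D(C, M)`: the linear map `ρ` determined by
`(ρ ⊗ id) ∘ unit = (id ⊗ Δ) ∘ unit`. -/
noncomputable def shriekCoact : shriekCarrier α M →ₗ[K] shriekCarrier α M ⊗[K] C :=
  cohomDesc (N := corestrictObj α (regular K C)) (shriekAux α M)

theorem shriekCoact_unit (m : M.carrier) :
    (shriekCoact α M).rTensor C (shriekUnit α M m) =
      tensorComul C (shriekCarrier α M) (shriekUnit α M m) :=
  LinearMap.congr_fun (cohomDesc_unit (N := corestrictObj α (regular K C)) (shriekAux α M)) m

/-- The comodule `α^! M = H_D(C, M)`. -/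
noncomputable def shriekObj : RightComodule K C where
  carrier := shriekCarrier α M
  coact := shriekCoact α M
  coassoc := by
    apply shriek_hom_ext
    ext m
    have h : (TensorProduct.assoc K (shriekCarrier α M) C C).toLinearMap ∘ₗ
        tensorComul C (shriekCarrier α M) = Coalgebra.comul.lTensor (shriekCarrier α M) := by
      ext x c
      simp [tensorComul]
    simp only [LinearMap.comp_apply, LinearMap.rTensor_comp_apply]
    rw [shriekCoact_unit, tensorComul_natural, shriekCoact_unit, tensorComul_coassoc,
      ← LinearMap.rTensor_comp_apply, h]
  rid_counit := by
    apply shriek_hom_ext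
    ext m
    change (tensorCounit C (shriekCarrier α M) ∘ₗ shriekCoact α M).rTensor C
      (shriekUnit α M m) = (LinearMap.id).rTensor C (shriekUnit α M m)
    rw [LinearMap.rTensor_comp_apply, shriekCoact_unit, tensorCounit_rTensor_tensorComul]
    simp

/-- The linear map `g ∘ (id ⊗ ε) ∘ unit : M → W` of a linear map `g : H_D(C, M) → W`. -/
noncomputable def shriekTranspose {V : Type u} [AddCommGroup V] [Module K V]
    (g : shriekCarrier α M →ₗ[K] V) : M.carrier →ₗ[K] V :=
  g ∘ₗ tensorCounit C (shriekCarrier α M) ∘ₗ shriekUnit α M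

theorem coact_shriekTranspose {W : RightComodule K C} (g : shriekObj α M ⟶ W) (m : M.carrier) :
    W.coact (shriekTranspose α M (linMap g) m) =
      LinearMap.rTensor C (linMap g) (shriekUnit α M m) := by
  have h := LinearMap.congr_fun (linMap_comm g)
    (tensorCounit C (shriekCarrier α M) (shriekUnit α M m))
  have h2 : shriekCoact α M (tensorCounit C (shriekCarrier α M) (shriekUnit α M m)) =
      shriekUnit α M m := by
    rw [← tensorCounit_natural, shriekCoact_unit, tensorCounit_tensorComul]
  refine h.trans ?_
  change LinearMap.rTensor C (linMap g) (shriekCoact α M _) = _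
  rw [h2]

/-- The morphism `M → W ⊗ C` of `D`-comodules given by `ρ ∘ f`, for `f : M → α^* W`. -/
noncomputable def shriekLift {W : RightComodule K C} (f : M ⟶ corestrictObj α W) :
    M ⟶ tensorObj W.carrier (corestrictObj α (regular K C)) :=
  Hom.mk (M := M) (N := tensorObj W.carrier (corestrictObj α (regular K C)))
    (W.coact ∘ₗ linMap f) (by
      ext m
      let f' : M.carrier →ₗ[K] W.carrier := linMap f
      have h : α.toLinearMap.lTensor W.carrier (W.coact (linMap f m)) =
          LinearMap.rTensor D (linMap f) (M.coact m) := LinearMap.congr_fun (linMap_comm f) m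
      have h2 : ∀ w : W.carrier,
          (tensorObj W.carrier (corestrictObj α (regular K C))).coact (W.coact w) =
            W.coact.rTensor D (α.toLinearMap.lTensor W.carrier (W.coact w)) := by
        intro w
        refine (tensorObj_regular_coact α (W.coact w)).trans ?_
        rw [← coact_rTensor_coact, lTensor_rTensor_swap]
      exact (h2 (linMap f m)).trans <| (congrArg (W.coact.rTensor D) h).trans
        (LinearMap.rTensor_comp_apply D W.coact f' (M.coact m)).symm)

theorem cohomDesc_shriekLift {W : RightComodule K C} (f : M ⟶ corestrictObj α W)
    (m : M.carrier) :
    (cohomDesc (N := corestrictObj α (regular K C)) (shriekLift α M f)).rTensor C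
      (shriekUnit α M m) = W.coact (linMap f m) :=
  LinearMap.congr_fun (cohomDesc_unit (N := corestrictObj α (regular K C)) (shriekLift α M f)) m

theorem shriekTranspose_comm {V : Type u} [AddCommGroup V] [Module K V]
    (g : shriekCarrier α M →ₗ[K] V) (m : M.carrier) :
    (shriekTranspose α M g).rTensor D (M.coact m) =
      α.toLinearMap.lTensor V (g.rTensor C (shriekUnit α M m)) := by
  rw [shriekTranspose, LinearMap.rTensor_comp_apply, LinearMap.rTensor_comp_apply,
    shriekUnit_comm, ← lTensor_rTensor_swap, tensorCounit_rTensor_tensorComul,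
    lTensor_rTensor_swap]

theorem cohomDesc_shriekLift_comm {W : RightComodule K C} (f : M ⟶ corestrictObj α W) :
    W.coact ∘ₗ cohomDesc (N := corestrictObj α (regular K C)) (shriekLift α M f) =
      (cohomDesc (N := corestrictObj α (regular K C)) (shriekLift α M f)).rTensor C ∘ₗ
        shriekCoact α M := by
  have h := cohomDesc_shriekLift α M f
  set g : shriekCarrier α M →ₗ[K] W.carrier :=
    cohomDesc (N := corestrictObj α (regular K C)) (shriekLift α M f)
  apply shriek_hom_ext
  ext m
  rw [LinearMap.comp_apply, LinearMap.comp_apply, LinearMap.rTensor_comp_apply,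
    LinearMap.rTensor_comp_apply, shriekCoact_unit, tensorComul_natural]
  exact (congrArg (W.coact.rTensor C) (h m)).trans
    ((coact_rTensor_coact W _).trans (congrArg (tensorComul C W.carrier) (h m)).symm)

/-- The bijection between morphisms `α^! M → W` of `C`-comodules and morphisms `M → α^* W` of
`D`-comodules: `g` corresponds to `g ∘ (id ⊗ ε) ∘ unit`. -/
noncomputable def shriekEquiv (W : RightComodule K C) :
    (shriekObj α M ⟶ W) ≃ (M ⟶ corestrictObj α W) where
  toFun g := Hom.mk (M := M) (N := corestrictObj α W) (shriekTranspose α M (linMap g)) (by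
    ext m
    exact (congrArg (α.toLinearMap.lTensor W.carrier) (coact_shriekTranspose α M g m)).trans
      (shriekTranspose_comm α M (linMap g) m).symm)
  invFun f := Hom.mk (M := shriekObj α M) (N := W)
    (cohomDesc (N := corestrictObj α (regular K C)) (shriekLift α M f))
    (cohomDesc_shriekLift_comm α M f)
  left_inv g := by
    apply hom_ext
    apply shriek_hom_ext
    ext m
    exact (cohomDesc_shriekLift α M _ m).trans (coact_shriekTranspose α M g m)
  right_inv f := by
    apply hom_ext
    ext m
    have h := (tensorCounit_natural
      (cohomDesc (N := corestrictObj α (regular K C)) (shriekLift α M f))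
      (shriekUnit α M m)).symm
    exact h.trans ((congrArg (tensorCounit C W.carrier) (cohomDesc_shriekLift α M f m)).trans
      (tensorCounit_coact W _))

end shriek

/-- The functor `α^! = H_D(C, -) : M^D ⥤ M^C` of a quasi-finite morphism `α : C → D`. -/
noncomputable def shriek (α : C →ₗc[K] D) [IsQuasiFiniteHom α] :
    RightComodule K D ⥤ RightComodule K C :=
  Adjunction.leftAdjointOfEquiv (G := corestrict α) (F_obj := shriekObj α) (shriekEquiv α) (fun _ _ _ _ _ => rfl)

/-- The functor `α^!` is left adjoint to the corestriction functor `α^*`. -/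
noncomputable def shriekAdj (α : C →ₗc[K] D) [IsQuasiFiniteHom α] : shriek α ⊣ corestrict α :=
  Adjunction.adjunctionOfEquivLeft (G := corestrict α) (F_obj := shriekObj α) (shriekEquiv α) (fun _ _ _ _ _ => rfl)

/-- The left coaction `N → C ⊗ N` obtained from the right coaction by the flip; it makes a right
comodule over a cocommutative coalgebra a bicomodule. -/
def leftCoact (N : RightComodule K C) : N.carrier →ₗ[K] C ⊗[K] N.carrier :=
  (TensorProduct.comm K N.carrier C).toLinearMap ∘ₗ N.coact

/-- The quotient of a comodule `P` by a subspace `S` such that the coaction of `P` descends to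
`P ⧸ S`. -/
def quotient (P : RightComodule K C) (S : Submodule K P.carrier)
    (hS : S ≤ LinearMap.ker (S.mkQ.rTensor C ∘ₗ P.coact)) : RightComodule K C where
  carrier := P.carrier ⧸ S
  coact := S.liftQ (S.mkQ.rTensor C ∘ₗ P.coact) hS
  coassoc := by
    apply Submodule.linearMap_qext
    ext p
    have h1 : (S.liftQ (S.mkQ.rTensor C ∘ₗ P.coact) hS) ∘ₗ S.mkQ = S.mkQ.rTensor C ∘ₗ P.coact :=
      Submodule.liftQ_mkQ _ _ _
    have h2 : (TensorProduct.assoc K (P.carrier ⧸ S) C C).toLinearMap ∘ₗ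
        tensorComul C (P.carrier ⧸ S) = Coalgebra.comul.lTensor (P.carrier ⧸ S) := by
      ext x c
      simp [tensorComul]
    have h3 := LinearMap.congr_fun h1 p
    simp only [LinearMap.comp_apply] at h3 ⊢
    rw [h3, ← LinearMap.rTensor_comp_apply, h1, LinearMap.rTensor_comp_apply, coact_rTensor_coact,
      tensorComul_natural, ← h2, LinearMap.comp_apply]
  rid_counit := by
    apply Submodule.linearMap_qext
    ext p
    have h3 := LinearMap.congr_fun (Submodule.liftQ_mkQ S (S.mkQ.rTensor C ∘ₗ P.coact) hS) p
    simp only [LinearMap.comp_apply] at h3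
    change tensorCounit C (P.carrier ⧸ S) (S.liftQ (S.mkQ.rTensor C ∘ₗ P.coact) hS (S.mkQ p)) =
      S.mkQ p
    rw [h3, tensorCounit_natural, tensorCounit_coact]

end RightComodule

/-! ### Right contramodules -/

/-- A right contramodule over a `K`-coalgebra `C`: a vector space with a contraaction
`π : Hom(C, M) → M` that is counital and contraassociative, where `Hom(C, Hom(C, M))` is identified
with `Hom(C ⊗ C, M)` by `F ↦ (c ⊗ d ↦ F c d)`. -/
structure RightContramodule (K : Type u) [Field K] (C : Type u) [AddCommGroup C] [Module K C]
    [Coalgebra K C] where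
  carrier : Type u
  [addCommGroup : AddCommGroup carrier]
  [module : Module K carrier]
  act : (C →ₗ[K] carrier) →ₗ[K] carrier
  act_counit : ∀ m : carrier, act ((Coalgebra.counit (R := K) (A := C)).smulRight m) = m
  act_assoc : ∀ F : C →ₗ[K] (C →ₗ[K] carrier),
    act (act ∘ₗ F) = act (TensorProduct.lift F ∘ₗ Coalgebra.comul)

attribute [instance] RightContramodule.addCommGroup RightContramodule.module

namespace RightContramodule

variable {K : Type u} [Field K]
variable {C : Type u} [AddCommGroup C] [Module K C] [Coalgebra K C]
variable {D : Type u} [AddCommGroup D] [Module K D] [Coalgebra K D]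

/-- A morphism of right contramodules: a linear map that commutes with the contraactions. -/
@[ext]
structure Hom (M N : RightContramodule K C) where
  lin : M.carrier →ₗ[K] N.carrier
  comm : ∀ f : C →ₗ[K] M.carrier, lin (M.act f) = N.act (lin ∘ₗ f)

/-- The category of right `C`-contramodules. -/
instance : Category (RightContramodule K C) where
  Hom M N := Hom M N
  id M := ⟨LinearMap.id, fun _ => rfl⟩
  comp f g := ⟨g.lin ∘ₗ f.lin, fun h => by
    rw [LinearMap.comp_apply, f.comm, g.comm, LinearMap.comp_assoc]⟩

/-- The underlying linear map of a morphism of contramodules. -/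
def linMap {M N : RightContramodule K C} (f : M ⟶ N) : M.carrier →ₗ[K] N.carrier := Hom.lin f

/-- The contrarestriction `α_• M` of a right `C`-contramodule along a morphism `α : C → D` of
coalgebras: the contraaction is `f ↦ π (f ∘ α)`. -/
def contrarestrictObj (α : C →ₗc[K] D) (M : RightContramodule K C) : RightContramodule K D where
  carrier := M.carrier
  act := M.act ∘ₗ LinearMap.lcomp K M.carrier α.toLinearMap
  act_counit m := by
    have h : (LinearMap.lcomp K M.carrier α.toLinearMap)
        ((Coalgebra.counit (R := K) (A := D)).smulRight m) =
          (Coalgebra.counit (R := K) (A := C)).smulRight m := by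
      ext c
      simp
    rw [LinearMap.comp_apply, h, M.act_counit]
  act_assoc F := by
    have h := M.act_assoc (LinearMap.lcomp K M.carrier α.toLinearMap ∘ₗ F ∘ₗ α.toLinearMap)
    have h2 : TensorProduct.lift (LinearMap.lcomp K M.carrier α.toLinearMap ∘ₗ F ∘ₗ α.toLinearMap) =
        TensorProduct.lift F ∘ₗ TensorProduct.map α.toLinearMap α.toLinearMap := by
      ext c d
      simp
    have h3 : (TensorProduct.map α.toLinearMap α.toLinearMap) ∘ₗ
        Coalgebra.comul (R := K) (A := C) = Coalgebra.comul ∘ₗ α.toLinearMap :=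
      α.map_comp_comul
    rw [h2, LinearMap.comp_assoc, h3] at h
    exact h

/-- The contrarestriction functor `α_•` along a morphism `α : C → D` of coalgebras. -/
def contrarestrict (α : C →ₗc[K] D) : RightContramodule K C ⥤ RightContramodule K D where
  obj M := contrarestrictObj α M
  map {M N} f := Hom.mk (M := contrarestrictObj α M) (N := contrarestrictObj α N) (linMap f :)
    (fun g => Hom.comm f (g ∘ₗ α.toLinearMap))

end RightContramodule

/-! ### Contratensor product and the contramodule of comodule morphisms -/

section

variable {K : Type u} [Field K]
variable {C : Type u} [AddCommGroup C] [Module K C] [Coalgebra K C]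

open RightComodule

/-- The map `Hom(C, M) ⊗ N → M ⊗ N` induced by the coaction `N → C ⊗ N` and evaluation. -/
def contratensorEval (M : RightContramodule K C) (N : RightComodule K C) :
    (C →ₗ[K] M.carrier) ⊗[K] N.carrier →ₗ[K] M.carrier ⊗[K] N.carrier :=
  (TensorProduct.lift (LinearMap.id : (C →ₗ[K] M.carrier) →ₗ[K] (C →ₗ[K] M.carrier))).rTensor
      N.carrier ∘ₗ
    (TensorProduct.assoc K (C →ₗ[K] M.carrier) C N.carrier).symm.toLinearMap ∘ₗ
      (leftCoact N).lTensor (C →ₗ[K] M.carrier)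

/-- The subspace of `M ⊗ N` whose quotient is the coequalizer of the two maps
`Hom(C, M) ⊗ N → M ⊗ N`. -/
def contratensorRel (M : RightContramodule K C) (N : RightComodule K C) :
    Submodule K (M.carrier ⊗[K] N.carrier) :=
  LinearMap.range (M.act.rTensor N.carrier - contratensorEval M N)

/-- The coaction of `C` on `V ⊗ N` through `N`. -/
def tensorCoact (V : Type u) [AddCommGroup V] [Module K V] (N : RightComodule K C) :
    V ⊗[K] N.carrier →ₗ[K] (V ⊗[K] N.carrier) ⊗[K] C :=
  (TensorProduct.assoc K V N.carrier C).symm.toLinearMap ∘ₗ N.coact.lTensor V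

theorem coact_swap [Coalgebra.IsCocomm K C] (N : RightComodule K C) (n : N.carrier) :
    (TensorProduct.comm K C C).toLinearMap.lTensor N.carrier
        (TensorProduct.assoc K N.carrier C C (N.coact.rTensor C (N.coact n))) =
      TensorProduct.assoc K N.carrier C C (N.coact.rTensor C (N.coact n)) := by
  have h := LinearMap.congr_fun N.coassoc n
  simp only [LinearMap.comp_apply, LinearEquiv.coe_coe] at h
  rw [h, ← LinearMap.lTensor_comp_apply, Coalgebra.IsCocomm.comm_comp_comul]

theorem contratensorEval_coact [Coalgebra.IsCocomm K C] (M : RightContramodule K C)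
    (N : RightComodule K C) :
    tensorCoact M.carrier N ∘ₗ contratensorEval M N =
      (contratensorEval M N).rTensor C ∘ₗ tensorCoact (C →ₗ[K] M.carrier) N := by
  ext f n
  let Ψ : N.carrier ⊗[K] (C ⊗[K] C) →ₗ[K] (M.carrier ⊗[K] N.carrier) ⊗[K] C :=
    ((TensorProduct.comm K N.carrier M.carrier).toLinearMap ∘ₗ f.lTensor N.carrier).rTensor C ∘ₗ
      (TensorProduct.assoc K N.carrier C C).symm.toLinearMap
  have h1 : ∀ t : N.carrier ⊗[K] C, (contratensorEval M N).rTensor C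
      ((TensorProduct.assoc K (C →ₗ[K] M.carrier) N.carrier C).symm (f ⊗ₜ t)) =
        Ψ (TensorProduct.assoc K N.carrier C C (N.coact.rTensor C t)) := by
    intro t
    induction t using TensorProduct.induction_on with
    | zero => simp
    | add a b ha hb => simp only [map_add, TensorProduct.tmul_add, ha, hb]
    | tmul a c =>
      simp only [contratensorEval, leftCoact, LinearMap.comp_apply, LinearMap.lTensor_tmul,
        LinearEquiv.coe_coe, LinearMap.rTensor_tmul, TensorProduct.assoc_symm_tmul]
      induction N.coact a using TensorProduct.induction_on with
      | zero => simp
      | add a b ha hb =>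
        simp only [map_add, TensorProduct.tmul_add, TensorProduct.add_tmul, ha, hb]
      | tmul a b => simp [Ψ]
  have h2 : ∀ t : N.carrier ⊗[K] C, tensorCoact M.carrier N
      ((TensorProduct.comm K N.carrier M.carrier) (f.lTensor N.carrier t)) =
        Ψ ((TensorProduct.comm K C C).toLinearMap.lTensor N.carrier
          (TensorProduct.assoc K N.carrier C C (N.coact.rTensor C t))) := by
    intro t
    induction t using TensorProduct.induction_on with
    | zero => simp
    | add a b ha hb => simp only [map_add, ha, hb]
    | tmul a c =>
      simp only [tensorCoact, LinearMap.comp_apply, LinearMap.lTensor_tmul,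
        LinearEquiv.coe_coe, LinearMap.rTensor_tmul, TensorProduct.comm_tmul]
      induction N.coact a using TensorProduct.induction_on with
      | zero => simp
      | add a b ha hb =>
        simp only [map_add, TensorProduct.tmul_add, TensorProduct.add_tmul, ha, hb]
      | tmul a b => simp [Ψ]
  have h3 : contratensorEval M N (f ⊗ₜ n) =
      (TensorProduct.comm K N.carrier M.carrier) (f.lTensor N.carrier (N.coact n)) := by
    simp only [contratensorEval, leftCoact, LinearMap.comp_apply, LinearMap.lTensor_tmul,
      LinearEquiv.coe_coe]
    induction N.coact n using TensorProduct.induction_on with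
    | zero => simp
    | add a b ha hb => simp only [map_add, TensorProduct.tmul_add, ha, hb]
    | tmul a b => simp
  have h4 : tensorCoact (C →ₗ[K] M.carrier) N (f ⊗ₜ n) =
      (TensorProduct.assoc K (C →ₗ[K] M.carrier) N.carrier C).symm (f ⊗ₜ N.coact n) := by
    simp [tensorCoact]
  simp only [TensorProduct.AlgebraTensorModule.curry_apply, LinearMap.restrictScalars_self,
    TensorProduct.curry_apply, LinearMap.comp_apply]
  rw [h3, h2, coact_swap, h4, h1]

theorem tensorCoact_natural {V W : Type u} [AddCommGroup V] [Module K V] [AddCommGroup W]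
    [Module K W] (f : V →ₗ[K] W) (N : RightComodule K C) :
    tensorCoact W N ∘ₗ f.rTensor N.carrier =
      (f.rTensor N.carrier).rTensor C ∘ₗ tensorCoact V N := by
  ext v n
  simp only [tensorCoact, TensorProduct.AlgebraTensorModule.curry_apply,
    LinearMap.restrictScalars_self, TensorProduct.curry_apply, LinearMap.comp_apply,
    LinearMap.lTensor_tmul, LinearMap.rTensor_tmul, LinearEquiv.coe_coe]
  induction N.coact n using TensorProduct.induction_on with
  | zero => simp
  | add a b ha hb => simp only [map_add, TensorProduct.tmul_add, ha, hb]
  | tmul n c => simp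

theorem contratensorRel_le [Coalgebra.IsCocomm K C] (M : RightContramodule K C)
    (N : RightComodule K C) :
    contratensorRel M N ≤
      LinearMap.ker ((contratensorRel M N).mkQ.rTensor C ∘ₗ (tensorObj M.carrier N).coact) := by
  rintro _ ⟨t, rfl⟩
  change (contratensorRel M N).mkQ.rTensor C (tensorCoact M.carrier N
    ((M.act.rTensor N.carrier - contratensorEval M N) t)) = 0
  have h : tensorCoact M.carrier N ∘ₗ (M.act.rTensor N.carrier - contratensorEval M N) =
      (M.act.rTensor N.carrier - contratensorEval M N).rTensor C ∘ₗ
        tensorCoact (C →ₗ[K] M.carrier) N := by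
    rw [LinearMap.comp_sub, tensorCoact_natural, contratensorEval_coact, LinearMap.rTensor_sub,
      LinearMap.sub_comp]
  have h2 : (contratensorRel M N).mkQ ∘ₗ (M.act.rTensor N.carrier - contratensorEval M N) = 0 :=
    LinearMap.range_mkQ_comp _
  have h3 := LinearMap.congr_fun h t
  refine (congrArg ((contratensorRel M N).mkQ.rTensor C) h3).trans ?_
  rw [LinearMap.comp_apply, ← LinearMap.rTensor_comp_apply, h2]
  simp

/-- The contratensor product `M ⊠_C N` of a contramodule and a comodule over a cocommutative
coalgebra: the coequalizer of the two maps `Hom(C, M) ⊗ N → M ⊗ N`, with the coaction induced by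
that of `N`. -/
def contratensor [Coalgebra.IsCocomm K C] (M : RightContramodule K C) (N : RightComodule K C) :
    RightComodule K C :=
  (tensorObj M.carrier N).quotient (contratensorRel M N) (contratensorRel_le M N)

/-- The class of `m ⊗ n` in `M ⊠_C N`. -/
def contratensor.tmul [Coalgebra.IsCocomm K C] {M : RightContramodule K C} {N : RightComodule K C}
    (m : M.carrier) (n : N.carrier) : (contratensor M N).carrier :=
  (contratensorRel M N).mkQ (m ⊗ₜ[K] n)

/-- For `f : C → Hom_C(N, P)`, the linear map `n ↦ f(n₍₋₁₎)(n₍₀₎)`. -/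
def comHomActAux (N P : RightComodule K C) :
    (C →ₗ[K] homs N P) →ₗ[K] (N.carrier →ₗ[K] P.carrier) where
  toFun f := TensorProduct.lift ((homs N P).subtype ∘ₗ f) ∘ₗ leftCoact N
  map_add' f g := by
    ext n
    simp only [LinearMap.comp_apply, LinearMap.add_apply, LinearMap.comp_add]
    induction leftCoact N n using TensorProduct.induction_on with
    | zero => simp
    | add a b ha hb => simp only [map_add, ha, hb]; abel
    | tmul a b => simp
  map_smul' c f := by
    ext n
    simp only [LinearMap.comp_apply, LinearMap.smul_apply, LinearMap.comp_smul, RingHom.id_apply]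
    induction leftCoact N n using TensorProduct.induction_on with
    | zero => simp
    | add a b ha hb => simp only [map_add, ha, hb, smul_add]
    | tmul a b => simp

theorem comHomActAux_apply (N P : RightComodule K C) (f : C →ₗ[K] homs N P) (n : N.carrier) :
    comHomActAux N P f n =
      TensorProduct.lift ((homs N P).subtype ∘ₗ f)
        (TensorProduct.comm K N.carrier C (N.coact n)) := rfl

theorem comHomActAux_mem [Coalgebra.IsCocomm K C] (N P : RightComodule K C)
    (f : C →ₗ[K] homs N P) : comHomActAux N P f ∈ homs N P := by
  change P.coact ∘ₗ comHomActAux N P f = (comHomActAux N P f).rTensor C ∘ₗ N.coact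
  ext n
  let e : N.carrier ⊗[K] C →ₗ[K] P.carrier :=
    TensorProduct.lift ((homs N P).subtype ∘ₗ f) ∘ₗ (TensorProduct.comm K N.carrier C).toLinearMap
  let Ψ : N.carrier ⊗[K] (C ⊗[K] C) →ₗ[K] P.carrier ⊗[K] C :=
    e.rTensor C ∘ₗ (TensorProduct.assoc K N.carrier C C).symm.toLinearMap
  have h1 : ∀ t : N.carrier ⊗[K] C, (comHomActAux N P f).rTensor C t =
      Ψ (TensorProduct.assoc K N.carrier C C (N.coact.rTensor C t)) := by
    intro t
    induction t using TensorProduct.induction_on with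
    | zero => simp
    | add a b ha hb => simp only [map_add, ha, hb]
    | tmul a c => simp [Ψ, e, comHomActAux_apply]
  have h2 : ∀ t : N.carrier ⊗[K] C, P.coact (e t) =
      Ψ ((TensorProduct.comm K C C).toLinearMap.lTensor N.carrier
        (TensorProduct.assoc K N.carrier C C (N.coact.rTensor C t))) := by
    intro t
    induction t using TensorProduct.induction_on with
    | zero => simp
    | add a b ha hb => simp only [map_add, ha, hb]
    | tmul a c =>
      have h : P.coact ((f c : N.carrier →ₗ[K] P.carrier) a) =
          (f c : N.carrier →ₗ[K] P.carrier).rTensor C (N.coact a) :=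
        LinearMap.congr_fun (f c).2 a
      have h' : e (a ⊗ₜ c) = (f c : N.carrier →ₗ[K] P.carrier) a := by simp [e]
      rw [h', h, LinearMap.rTensor_tmul]
      induction N.coact a using TensorProduct.induction_on with
      | zero => simp
      | add a b ha hb => simp only [map_add, TensorProduct.add_tmul, ha, hb]
      | tmul a b => simp [Ψ, e]
  rw [LinearMap.comp_apply, LinearMap.comp_apply, h1, ← coact_swap, ← h2]
  rfl

/-- The right contramodule `Hom_C(N, P)` of morphisms of right comodules over a cocommutative
coalgebra `C`, with the contraaction `π(f)(n) = f(n₍₋₁₎)(n₍₀₎)`. -/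
def comHom [Coalgebra.IsCocomm K C] (N P : RightComodule K C) : RightContramodule K C where
  carrier := homs N P
  act := LinearMap.codRestrict (homs N P) (comHomActAux N P) (comHomActAux_mem N P)
  act_counit φ := by
    apply Subtype.ext
    ext n
    change comHomActAux N P (Coalgebra.counit.smulRight φ) n = φ.1 n
    have h : ∀ t : N.carrier ⊗[K] C,
        TensorProduct.lift ((homs N P).subtype ∘ₗ Coalgebra.counit.smulRight φ)
          (TensorProduct.comm K N.carrier C t) = φ.1 (tensorCounit C N.carrier t) := by
      intro t
      induction t using TensorProduct.induction_on with
      | zero => simp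
      | add a b ha hb => simp only [map_add, ha, hb]
      | tmul a c => simp [tensorCounit]
    rw [comHomActAux_apply, h, tensorCounit_coact]
  act_assoc F := by
    apply Subtype.ext
    ext n
    let act := LinearMap.codRestrict (homs N P) (comHomActAux N P) (comHomActAux_mem N P)
    change comHomActAux N P (act ∘ₗ F) n =
      comHomActAux N P (TensorProduct.lift F ∘ₗ Coalgebra.comul) n
    let Ψ : N.carrier ⊗[K] (C ⊗[K] C) →ₗ[K] P.carrier :=
      TensorProduct.lift ((homs N P).subtype ∘ₗ TensorProduct.lift F) ∘ₗ
        (TensorProduct.comm K N.carrier (C ⊗[K] C)).toLinearMap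
    have h1 : ∀ t : N.carrier ⊗[K] C,
        TensorProduct.lift ((homs N P).subtype ∘ₗ act ∘ₗ F) (TensorProduct.comm K N.carrier C t) =
          Ψ ((TensorProduct.comm K C C).toLinearMap.lTensor N.carrier
            (TensorProduct.assoc K N.carrier C C (N.coact.rTensor C t))) := by
      intro t
      induction t using TensorProduct.induction_on with
      | zero => simp
      | add a b ha hb => simp only [map_add, ha, hb]
      | tmul a c =>
        have h : TensorProduct.lift ((homs N P).subtype ∘ₗ act ∘ₗ F)
            (TensorProduct.comm K N.carrier C (a ⊗ₜ c)) = comHomActAux N P (F c) a := rfl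
        rw [h, comHomActAux_apply, LinearMap.rTensor_tmul]
        induction N.coact a using TensorProduct.induction_on with
        | zero => simp
        | add a b ha hb => simp only [map_add, TensorProduct.add_tmul, ha, hb]
        | tmul a b => simp [Ψ]
    have h2 : ∀ t : N.carrier ⊗[K] C,
        TensorProduct.lift ((homs N P).subtype ∘ₗ TensorProduct.lift F ∘ₗ Coalgebra.comul)
          (TensorProduct.comm K N.carrier C t) = Ψ (Coalgebra.comul.lTensor N.carrier t) := by
      intro t
      induction t using TensorProduct.induction_on with
      | zero => simp
      | add a b ha hb => simp only [map_add, ha, hb]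
      | tmul a c => simp [Ψ]
    have h3 := LinearMap.congr_fun N.coassoc n
    simp only [LinearMap.comp_apply, LinearEquiv.coe_coe] at h3
    rw [comHomActAux_apply, comHomActAux_apply, h1, h2, coact_swap, h3]

end

/-! ### Trans-comodules and trans-contramodules over a coalgebra representation -/

section

variable {K : Type u} [Field K] {X : Type w₁} [Category.{w₂} X]

/-- A trans-comodule over a coalgebra representation `𝒞`: comodules `M_x` over `𝒞_x` with
morphisms `M_y → α^* M_x` for the morphisms `α : x → y`, compatible with identities and
composition. -/
structure TransComodule (𝒞 : X ⥤ CoalgCat.{u} K) where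
  obj : ∀ x : X, RightComodule K (𝒞.obj x)
  map : ∀ {x y : X} (α : x ⟶ y),
    obj y ⟶ (RightComodule.corestrict (𝒞.map α).toCoalgHom).obj (obj x)
  map_id : ∀ (x : X) (m : (obj x).carrier), RightComodule.linMap (map (𝟙 x)) m = m
  map_comp : ∀ {x y z : X} (α : x ⟶ y) (β : y ⟶ z) (m : (obj z).carrier),
    RightComodule.linMap (map (α ≫ β)) m =
      RightComodule.linMap (map α) (RightComodule.linMap (map β) m)

/-- A trans-contramodule over a coalgebra representation `𝒞`: contramodules `M_x` over `𝒞_x` with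
morphisms `M_y → α_• M_x` for the morphisms `α : x → y`, compatible with identities and
composition. -/
structure TransContramodule (𝒞 : X ⥤ CoalgCat.{u} K) where
  obj : ∀ x : X, RightContramodule K (𝒞.obj x)
  map : ∀ {x y : X} (α : x ⟶ y),
    obj y ⟶ (RightContramodule.contrarestrict (𝒞.map α).toCoalgHom).obj (obj x)
  map_id : ∀ (x : X) (m : (obj x).carrier), RightContramodule.linMap (map (𝟙 x)) m = m
  map_comp : ∀ {x y z : X} (α : x ⟶ y) (β : y ⟶ z) (m : (obj z).carrier),
    RightContramodule.linMap (map (α ≫ β)) m =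
      RightContramodule.linMap (map α) (RightContramodule.linMap (map β) m)

/-- A coalgebra representation is quasi-finite if each `𝒞_α : 𝒞_x → 𝒞_y` makes `𝒞_x` a quasi-finite
right comodule over `𝒞_y`. -/
class IsQuasiFiniteRep (𝒞 : X ⥤ CoalgCat.{u} K) : Prop where
  isQuasiFiniteHom : ∀ {x y : X} (α : x ⟶ y),
    RightComodule.IsQuasiFiniteHom (𝒞.map α).toCoalgHom

attribute [instance] IsQuasiFiniteRep.isQuasiFiniteHom

variable {𝒞 : X ⥤ CoalgCat.{u} K}

namespace TransComodule

/-- A morphism of trans-comodules: morphisms of comodules at each object that commute with the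
structure morphisms. -/
@[ext]
structure Hom (M N : TransComodule 𝒞) where
  app : ∀ x : X, M.obj x ⟶ N.obj x
  naturality : ∀ {x y : X} (α : x ⟶ y),
    app y ≫ N.map α =
      M.map α ≫ (RightComodule.corestrict (𝒞.map α).toCoalgHom).map (app x)

/-- The category of trans-comodules over `𝒞`. -/
instance : Category (TransComodule 𝒞) where
  Hom M N := Hom M N
  id M := ⟨fun x => 𝟙 _, by simp⟩
  comp f g := ⟨fun x => f.app x ≫ g.app x, fun α => by
    rw [Category.assoc, g.naturality, Functor.map_comp, ← Category.assoc, f.naturality,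
      Category.assoc]⟩

/-- The component at `x` of a morphism of trans-comodules. -/
def app {M N : TransComodule 𝒞} (f : M ⟶ N) (x : X) : M.obj x ⟶ N.obj x := Hom.app f x

/-- The morphism `α^! M_y → M_x` that corresponds to the structure morphism `M_y → α^* M_x`. -/
noncomputable def shriekMap [IsQuasiFiniteRep 𝒞] (M : TransComodule 𝒞) {x y : X} (α : x ⟶ y) :
    (RightComodule.shriek (𝒞.map α).toCoalgHom).obj (M.obj y) ⟶ M.obj x :=
  ((RightComodule.shriekAdj (𝒞.map α).toCoalgHom).homEquiv _ _).symm (M.map α)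

/-- A trans-comodule over a quasi-finite representation is cartesian if all the morphisms
`α^! M_y → M_x` are isomorphisms. -/
def IsCartesian [IsQuasiFiniteRep 𝒞] (M : TransComodule 𝒞) : Prop :=
  ∀ ⦃x y : X⦄ (α : x ⟶ y), IsIso (M.shriekMap α)

end TransComodule

namespace TransContramodule

/-- A morphism of trans-contramodules: morphisms of contramodules at each object that commute with
the structure morphisms. -/
@[ext]
structure Hom (M N : TransContramodule 𝒞) where
  app : ∀ x : X, M.obj x ⟶ N.obj x
  naturality : ∀ {x y : X} (α : x ⟶ y),
    app y ≫ N.map α =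
      M.map α ≫ (RightContramodule.contrarestrict (𝒞.map α).toCoalgHom).map (app x)

/-- The category of trans-contramodules over `𝒞`. -/
instance : Category (TransContramodule 𝒞) where
  Hom M N := Hom M N
  id M := ⟨fun x => 𝟙 _, by simp⟩
  comp f g := ⟨fun x => f.app x ≫ g.app x, fun α => by
    rw [Category.assoc, g.naturality, Functor.map_comp, ← Category.assoc, f.naturality,
      Category.assoc]⟩

/-- The component at `x` of a morphism of trans-contramodules. -/
def app {M N : TransContramodule 𝒞} (f : M ⟶ N) (x : X) : M.obj x ⟶ N.obj x := Hom.app f x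

end TransContramodule

/-- `F` is the functor `M ↦ (M_x ⊠ N_x)_x`: for `α : y → x`, the structure morphism
`M_x ⊠ N_x → α^* (M_y ⊠ N_y)` sends the class of `m ⊗ n` to the class of `M_α m ⊗ N_α n`, and
`F` sends a morphism `φ` to the morphism with components `φ_x ⊠ id`. -/
structure IsContratensorFunctor [∀ x, Coalgebra.IsCocomm K (𝒞.obj x)] (N : TransComodule 𝒞)
    (F : TransContramodule 𝒞 ⥤ TransComodule 𝒞) : Prop where
  obj_eq : ∀ (M : TransContramodule 𝒞) (x : X),
    (F.obj M).obj x = contratensor (M.obj x) (N.obj x)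
  map_eq : ∀ (M : TransContramodule 𝒞) {y x : X} (α : y ⟶ x),
    ∃ f : contratensor (M.obj x) (N.obj x) ⟶
        (RightComodule.corestrict (𝒞.map α).toCoalgHom).obj (contratensor (M.obj y) (N.obj y)),
      (∀ (m : (M.obj x).carrier) (n : (N.obj x).carrier),
        RightComodule.linMap f (contratensor.tmul m n) =
          contratensor.tmul (M := M.obj y) (N := N.obj y)
            (RightContramodule.linMap (M.map α) m) (RightComodule.linMap (N.map α) n)) ∧
      (F.obj M).map α = eqToHom (obj_eq M x) ≫ f ≫
        (RightComodule.corestrict (𝒞.map α).toCoalgHom).map (eqToHom (obj_eq M y).symm)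
  hom_eq : ∀ {M M' : TransContramodule 𝒞} (φ : M ⟶ M') (x : X),
    ∃ f : contratensor (M.obj x) (N.obj x) ⟶ contratensor (M'.obj x) (N.obj x),
      (∀ (m : (M.obj x).carrier) (n : (N.obj x).carrier),
        RightComodule.linMap f (contratensor.tmul m n) =
          contratensor.tmul (RightContramodule.linMap (TransContramodule.app φ x) m) n) ∧
      TransComodule.app (F.map φ) x =
        eqToHom (obj_eq M x) ≫ f ≫ eqToHom (obj_eq M' x).symm

/-- `G` is the functor `P ↦ (Hom(N_x, P_x))_x`, for a cartesian `N`: for `α : y → x`, the structure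
morphism `Hom(N_x, P_x) → α_• Hom(N_y, P_y)` sends `φ` to the composite
`N_y ≅ α^! N_x → α^! P_x → P_y`, where the middle map is `α^! φ`, and `G` sends a morphism `ψ` to
the morphism with components `φ ↦ ψ_x ∘ φ`. -/
structure IsComHomFunctor [∀ x, Coalgebra.IsCocomm K (𝒞.obj x)] [IsQuasiFiniteRep 𝒞]
    (N : TransComodule 𝒞) (G : TransComodule 𝒞 ⥤ TransContramodule 𝒞) : Prop where
  obj_eq : ∀ (P : TransComodule 𝒞) (x : X),
    (G.obj P).obj x = comHom (N.obj x) (P.obj x)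
  map_eq : ∀ (P : TransComodule 𝒞) {y x : X} (α : y ⟶ x),
    ∃ g : comHom (N.obj x) (P.obj x) ⟶
        (RightContramodule.contrarestrict (𝒞.map α).toCoalgHom).obj (comHom (N.obj y) (P.obj y)),
      (∀ φ : RightComodule.homs (N.obj x) (P.obj x),
        N.shriekMap α ≫ RightComodule.ofHoms (RightContramodule.linMap g φ) =
          (RightComodule.shriek (𝒞.map α).toCoalgHom).map (RightComodule.ofHoms φ) ≫
            P.shriekMap α) ∧
      (G.obj P).map α = eqToHom (obj_eq P x) ≫ g ≫
        (RightContramodule.contrarestrict (𝒞.map α).toCoalgHom).map (eqToHom (obj_eq P y).symm)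
  hom_eq : ∀ {P P' : TransComodule 𝒞} (ψ : P ⟶ P') (x : X),
    ∃ g : comHom (N.obj x) (P.obj x) ⟶ comHom (N.obj x) (P'.obj x),
      (∀ φ : RightComodule.homs (N.obj x) (P.obj x),
        RightComodule.ofHoms (RightContramodule.linMap g φ) =
          RightComodule.ofHoms φ ≫ TransComodule.app ψ x) ∧
      TransContramodule.app (G.map ψ) x =
        eqToHom (obj_eq P x) ≫ g ≫ eqToHom (obj_eq P' x).symm

end

/-!
Over a single cocommutative coalgebra, `- ⊠_C N` is left adjoint to `M^C(N, -)`: a linear map out of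
`M ⊗ N` descends to the coequalizer precisely when its curried form commutes with contraactions.
Along `α : C → D`, precomposition with `f : N' → α^* N` is a morphism of contramodules
`α_• M^C(N, P) → M^D(N', α^* P)`. The structure maps of `F` are obtained from it by adjunction, and
when the transpose `α^! N' → N` of `f` is invertible it is itself an isomorphism, whose inverse
provides the structure maps of `G`. Naturality of a family `M_x ⊠ N_x → P_x` is thereby equivalent to naturality
of the curried family `M_x → M^{C_x}(N_x, P_x)`, and the adjunctions at all `x` assemble.
-/

theorem bijective_comp_map_of_isIso_homEquiv_symm {A B : Type*} [Category* A] [Category* B]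
    {L : A ⥤ B} {R : B ⥤ A} (adj : L ⊣ R) {a : A} {b : B} (f : a ⟶ R.obj b)
    [IsIso ((adj.homEquiv a b).symm f)] (w : B) :
    Function.Bijective fun g : b ⟶ w => f ≫ R.map g := by
  have h : (fun g : b ⟶ w => f ≫ R.map g) =
      adj.homEquiv a w ∘ fun g => (adj.homEquiv a b).symm f ≫ g := by
    funext g
    simp [adj.homEquiv_naturality_right]
  rw [h]
  exact (adj.homEquiv a w).bijective.comp
    ((asIso ((adj.homEquiv a b).symm f)).homFromEquiv (Z := w)).symm.bijective

section

variable {K : Type u} [Field K]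
variable {C : Type u} [AddCommGroup C] [Module K C] [Coalgebra K C]
variable {D : Type u} [AddCommGroup D] [Module K D] [Coalgebra K D]

namespace RightContramodule

theorem hom_ext {M N : RightContramodule K C} {f g : M ⟶ N} (h : ∀ m, linMap f m = linMap g m) :
    f = g :=
  Hom.ext (LinearMap.ext h)

theorem linMap_act {M N : RightContramodule K C} (f : M ⟶ N) (h : C →ₗ[K] M.carrier) :
    linMap f (M.act h) = N.act (linMap f ∘ₗ h) :=
  Hom.comm f h

theorem isIso_of_bijective {M N : RightContramodule K C} (f : M ⟶ N)
    (hf : Function.Bijective (linMap f)) : IsIso f := by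
  let e := LinearEquiv.ofBijective (linMap f) hf
  have he : linMap f ∘ₗ e.symm.toLinearMap = LinearMap.id := LinearMap.ext e.apply_symm_apply
  let g : N ⟶ M := Hom.mk (M := N) (N := M) e.symm.toLinearMap fun h => e.injective <| by
    change e (e.symm (N.act h)) = linMap f (M.act (e.symm.toLinearMap ∘ₗ h))
    rw [e.apply_symm_apply, linMap_act, ← LinearMap.comp_assoc, he, LinearMap.id_comp]
  exact ⟨g, hom_ext e.symm_apply_apply, hom_ext e.apply_symm_apply⟩

end RightContramodule

namespace RightComodule

/-- The elements of `homs M N` are the morphisms `M ⟶ N`. -/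
def homsEquiv (M N : RightComodule K C) : homs M N ≃ (M ⟶ N) where
  toFun := ofHoms
  invFun f := ⟨linMap f, linMap_comm f⟩

theorem rTensor_leftCoact_linMap {α : C →ₗc[K] D} {M : RightComodule K D}
    {N : RightComodule K C} (f : M ⟶ (corestrict α).obj N) (m : M.carrier) :
    LinearMap.rTensor N.carrier α.toLinearMap (leftCoact N (linMap f m)) =
      LinearMap.lTensor D (linMap f) (leftCoact M m) := by
  let f₀ : M.carrier →ₗ[K] N.carrier := linMap f
  calc α.toLinearMap.rTensor N.carrier (leftCoact N (f₀ m))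
      = TensorProduct.comm K N.carrier D (α.toLinearMap.lTensor N.carrier (N.coact (f₀ m))) :=
        TensorProduct.map_comm ..
    _ = TensorProduct.comm K N.carrier D (f₀.rTensor D (M.coact m)) :=
        congrArg _ (LinearMap.congr_fun (linMap_comm f) m)
    _ = f₀.lTensor D (leftCoact M m) := (TensorProduct.map_comm ..).symm

end RightComodule

open RightComodule

namespace comHom

variable [Coalgebra.IsCocomm K C]

/-- The morphism `ψ ↦ g ∘ ψ` of contramodules, which makes `Hom_C(N, -)` a functor. -/
def postcomp (N : RightComodule K C) {P P' : RightComodule K C} (g : P ⟶ P') :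
    comHom N P ⟶ comHom N P' :=
  let L : homs N P →ₗ[K] homs N P' := (LinearMap.compRight K (linMap g)).restrict
    fun ψ hψ => linMap_comm (ofHoms ⟨ψ, hψ⟩ ≫ g)
  RightContramodule.Hom.mk (M := comHom N P) (N := comHom N P') L fun F =>
    Subtype.ext <| LinearMap.ext fun n => by
      have h : linMap g ∘ₗ TensorProduct.lift ((homs N P).subtype ∘ₗ F) =
          TensorProduct.lift ((homs N P').subtype ∘ₗ L ∘ₗ F) :=
        TensorProduct.ext' fun _ _ => rfl
      exact LinearMap.congr_fun h (leftCoact N n)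

/-- The morphism `α_• Hom_C(N, P) → Hom_D(N', α^* P)` of contramodules given by precomposition with
a morphism `f : N' → α^* N`. -/
def precomp [Coalgebra.IsCocomm K D] (α : C →ₗc[K] D) {N' : RightComodule K D}
    {N : RightComodule K C} (f : N' ⟶ (corestrict α).obj N) (P : RightComodule K C) :
    (RightContramodule.contrarestrict α).obj (comHom N P) ⟶ comHom N' ((corestrict α).obj P) :=
  let f₀ : N'.carrier →ₗ[K] N.carrier := linMap f
  let L : homs N P →ₗ[K] homs N' ((corestrict α).obj P) :=
    (LinearMap.lcomp K P.carrier f₀).restrict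
      fun ψ hψ => linMap_comm (f ≫ (corestrict α).map (ofHoms ⟨ψ, hψ⟩))
  RightContramodule.Hom.mk (M := (RightContramodule.contrarestrict α).obj (comHom N P))
    (N := comHom N' ((corestrict α).obj P)) L fun (F : D →ₗ[K] homs N P) =>
    Subtype.ext <| LinearMap.ext fun n => by
      let B : D →ₗ[K] N.carrier →ₗ[K] P.carrier := (homs N P).subtype ∘ₗ F
      have hα : TensorProduct.lift (B ∘ₗ α.toLinearMap) =
          TensorProduct.lift B ∘ₗ α.toLinearMap.rTensor N.carrier :=
        TensorProduct.ext' fun _ _ => rfl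
      let B' : D →ₗ[K] N'.carrier →ₗ[K] P.carrier :=
        (homs N' ((corestrict α).obj P)).subtype ∘ₗ L ∘ₗ F
      have hf : TensorProduct.lift B ∘ₗ f₀.lTensor D = TensorProduct.lift B' :=
        TensorProduct.ext' fun _ _ => rfl
      calc TensorProduct.lift (B ∘ₗ α.toLinearMap) (leftCoact N (f₀ n))
          = TensorProduct.lift B (α.toLinearMap.rTensor N.carrier (leftCoact N (f₀ n))) :=
            LinearMap.congr_fun hα _
        _ = TensorProduct.lift B (f₀.lTensor D (leftCoact N' n)) :=
            congrArg _ (rTensor_leftCoact_linMap f n)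
        _ = TensorProduct.lift B' (leftCoact N' n) := LinearMap.congr_fun hf _

theorem isIso_precomp [Coalgebra.IsCocomm K D] (α : C →ₗc[K] D) [IsQuasiFiniteHom α]
    {N' : RightComodule K D} {N : RightComodule K C} (f : N' ⟶ (corestrict α).obj N)
    [IsIso (((shriekAdj α).homEquiv N' N).symm f)] (P : RightComodule K C) :
    IsIso (precomp α f P) :=
  RightContramodule.isIso_of_bijective _ <|
    (homsEquiv _ _).symm.bijective.comp <|
      (bijective_comp_map_of_isIso_homEquiv_symm (shriekAdj α) f P).comp
        (homsEquiv N P).bijective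

end comHom

theorem contratensorEval_tmul (M : RightContramodule K C) (N : RightComodule K C)
    (F : C →ₗ[K] M.carrier) (n : N.carrier) :
    contratensorEval M N (F ⊗ₜ n) = F.rTensor N.carrier (leftCoact N n) := by
  have h : (TensorProduct.lift LinearMap.id).rTensor N.carrier ∘ₗ
      (TensorProduct.assoc K (C →ₗ[K] M.carrier) C N.carrier).symm.toLinearMap ∘ₗ
        TensorProduct.mk K (C →ₗ[K] M.carrier) (C ⊗[K] N.carrier) F = F.rTensor N.carrier :=
    TensorProduct.ext' fun _ _ => rfl
  exact LinearMap.congr_fun h (leftCoact N n)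

variable [Coalgebra.IsCocomm K C]

theorem contratensorRel_le_ker_lift {M : RightContramodule K C} {N P : RightComodule K C}
    (g : M ⟶ comHom N P) :
    contratensorRel M N ≤
      LinearMap.ker (TensorProduct.lift ((homs N P).subtype ∘ₗ RightContramodule.linMap g)) := by
  rw [contratensorRel, LinearMap.range_le_ker_iff, LinearMap.comp_sub, sub_eq_zero]
  let B : M.carrier →ₗ[K] N.carrier →ₗ[K] P.carrier :=
    (homs N P).subtype ∘ₗ RightContramodule.linMap g
  refine TensorProduct.ext' fun F n => ?_
  have hlift : TensorProduct.lift (B ∘ₗ F) = TensorProduct.lift B ∘ₗ F.rTensor N.carrier :=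
    TensorProduct.ext' fun _ _ => rfl
  calc B (M.act F) n
      = TensorProduct.lift (B ∘ₗ F) (leftCoact N n) :=
        congrArg (fun ψ : homs N P => ψ.1 n) (RightContramodule.linMap_act g F)
    _ = TensorProduct.lift B (F.rTensor N.carrier (leftCoact N n)) := LinearMap.congr_fun hlift _
    _ = TensorProduct.lift B (contratensorEval M N (F ⊗ₜ n)) := by rw [contratensorEval_tmul]

namespace contratensor

/-- The bilinear map `(m, n) ↦ m ⊗ n` with values in `M ⊠_C N`. -/
def mk (M : RightContramodule K C) (N : RightComodule K C) :
    M.carrier →ₗ[K] N.carrier →ₗ[K] (contratensor M N).carrier :=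
  (TensorProduct.mk K M.carrier N.carrier).compr₂ (contratensorRel M N).mkQ

variable {M M' : RightContramodule K C} {N P P' : RightComodule K C}

theorem linearMap_ext {V : Type*} [AddCommGroup V] [Module K V]
    {f g : (contratensor M N).carrier →ₗ[K] V} (h : ∀ m n, f (tmul m n) = g (tmul m n)) : f = g :=
  Submodule.linearMap_qext _ (TensorProduct.ext' h)

theorem hom_ext {f g : contratensor M N ⟶ P}
    (h : ∀ m n, linMap f (tmul m n) = linMap g (tmul m n)) : f = g :=
  RightComodule.hom_ext (linearMap_ext h)

theorem act_tmul (F : C →ₗ[K] M.carrier) (n : N.carrier) :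
    tmul (M.act F) n = TensorProduct.lift (mk M N ∘ₗ F) (leftCoact N n) := by
  have hrel : (contratensorRel M N).mkQ (M.act F ⊗ₜ n) =
      (contratensorRel M N).mkQ (contratensorEval M N (F ⊗ₜ n)) :=
    (Submodule.Quotient.eq _).2 ⟨F ⊗ₜ n, rfl⟩
  have hlift : (contratensorRel M N).mkQ ∘ₗ F.rTensor N.carrier =
      TensorProduct.lift (mk M N ∘ₗ F) := TensorProduct.ext' fun _ _ => rfl
  exact hrel.trans <| (congrArg _ (contratensorEval_tmul M N F n)).trans <|
    LinearMap.congr_fun hlift (leftCoact N n)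

theorem coact_tmul (m : M.carrier) (n : N.carrier) :
    (contratensor M N).coact (tmul m n) = (mk M N m).rTensor C (N.coact n) := by
  have h : (contratensorRel M N).mkQ.rTensor C ∘ₗ
      (TensorProduct.assoc K M.carrier N.carrier C).symm.toLinearMap ∘ₗ
        TensorProduct.mk K M.carrier (N.carrier ⊗[K] C) m = (mk M N m).rTensor C :=
    TensorProduct.ext' fun _ _ => rfl
  exact LinearMap.congr_fun h (N.coact n)

/-- The unit `M → Hom_C(N, M ⊠_C N)`, `m ↦ (n ↦ m ⊗ n)`, of the adjunction between `- ⊠_C N` and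
`Hom_C(N, -)`. -/
def unit (M : RightContramodule K C) (N : RightComodule K C) : M ⟶ comHom N (contratensor M N) :=
  RightContramodule.Hom.mk (M := M) (N := comHom N (contratensor M N))
    (LinearMap.codRestrict (homs N (contratensor M N)) (mk M N)
      fun m => LinearMap.ext (coact_tmul m))
    fun F => Subtype.ext <| LinearMap.ext (act_tmul F)

/-- The morphism `M ⊠_C N → P`, `m ⊗ n ↦ g m n`, for a morphism `g : M → Hom_C(N, P)`. -/
def lift (g : M ⟶ comHom N P) : contratensor M N ⟶ P :=
  let g₀ : M.carrier →ₗ[K] homs N P := RightContramodule.linMap g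
  let L : (contratensor M N).carrier →ₗ[K] P.carrier :=
    (contratensorRel M N).liftQ _ (contratensorRel_le_ker_lift g)
  Hom.mk (M := contratensor M N) (N := P) L <| linearMap_ext fun m n => by
    have hL : (g₀ m).1.rTensor C = L.rTensor C ∘ₗ (mk M N m).rTensor C :=
      TensorProduct.ext' fun _ _ => rfl
    calc P.coact ((g₀ m).1 n)
        = (g₀ m).1.rTensor C (N.coact n) := LinearMap.congr_fun (g₀ m).2 n
      _ = L.rTensor C ((mk M N m).rTensor C (N.coact n)) := LinearMap.congr_fun hL _
      _ = L.rTensor C ((contratensor M N).coact (tmul m n)) :=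
          congrArg _ (coact_tmul m n).symm

/-- The adjunction between `- ⊠_C N` and `Hom_C(N, -)`. -/
def homEquiv : (contratensor M N ⟶ P) ≃ (M ⟶ comHom N P) where
  toFun h := unit M N ≫ comHom.postcomp N h
  invFun := lift
  left_inv _ := hom_ext fun _ _ => rfl
  right_inv _ := rfl

theorem homEquiv_naturality_right (h : contratensor M N ⟶ P) (g : P ⟶ P') :
    homEquiv (h ≫ g) = homEquiv h ≫ comHom.postcomp N g :=
  rfl

/-- The morphism `φ ⊠ f : M ⊠_D N → α^* (M' ⊠_C N')` for a morphism `φ : M → α_• M'` of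
contramodules and a morphism `f : N → α^* N'` of comodules. -/
def map [Coalgebra.IsCocomm K D] (α : C →ₗc[K] D) {M : RightContramodule K D}
    {N : RightComodule K D} {M' : RightContramodule K C} {N' : RightComodule K C}
    (φ : M ⟶ (RightContramodule.contrarestrict α).obj M') (f : N ⟶ (corestrict α).obj N') :
    contratensor M N ⟶ (corestrict α).obj (contratensor M' N') :=
  lift (φ ≫ (RightContramodule.contrarestrict α).map (unit M' N') ≫ comHom.precomp α f _)

theorem homEquiv_map_comp [Coalgebra.IsCocomm K D] (α : C →ₗc[K] D) {M : RightContramodule K D}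
    {N : RightComodule K D} {M' : RightContramodule K C} {N' : RightComodule K C}
    (φ : M ⟶ (RightContramodule.contrarestrict α).obj M') (f : N ⟶ (corestrict α).obj N')
    {P : RightComodule K C} (h : contratensor M' N' ⟶ P) :
    homEquiv (map α φ f ≫ (corestrict α).map h) =
      φ ≫ (RightContramodule.contrarestrict α).map (homEquiv h) ≫ comHom.precomp α f P :=
  rfl

/-- The morphism `φ ⊠ id`. -/
def mapLeft (φ : M ⟶ M') (N : RightComodule K C) : contratensor M N ⟶ contratensor M' N :=
  lift (φ ≫ unit M' N)

end contratensor

end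

section

variable {K : Type u} [Field K] {X : Type w₁} [Category.{w₂} X] {𝒞 : X ⥤ CoalgCat.{u} K}

open RightComodule

theorem TransComodule.hom_ext {M N : TransComodule 𝒞} {f g : M ⟶ N}
    (h : ∀ x, app f x = app g x) : f = g :=
  Hom.ext (funext h)

theorem TransContramodule.hom_ext {M N : TransContramodule 𝒞} {f g : M ⟶ N}
    (h : ∀ x, app f x = app g x) : f = g :=
  Hom.ext (funext h)

theorem TransComodule.IsCartesian.homs_ext [IsQuasiFiniteRep 𝒞] {N : TransComodule 𝒞}
    (hN : N.IsCartesian) {x y : X} (α : x ⟶ y) {P : RightComodule K (𝒞.obj x)}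
    {φ ψ : homs (N.obj x) P}
    (h : ∀ n, φ.1 (linMap (N.map α) n) = ψ.1 (linMap (N.map α) n)) : φ = ψ :=
  have : IsIso (((shriekAdj (𝒞.map α).toCoalgHom).homEquiv _ _).symm (N.map α)) := hN α
  (homsEquiv _ _).injective <|
    (bijective_comp_map_of_isIso_homEquiv_symm (shriekAdj _) (N.map α) P).injective <|
      RightComodule.hom_ext (LinearMap.ext h)

variable [∀ x, Coalgebra.IsCocomm K (𝒞.obj x)]

namespace TransContramodule

/-- The trans-comodule `(M_x ⊠ N_x)_x`, with structure maps `M_α ⊠ N_α`. -/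
def contratensorObj (M : TransContramodule 𝒞) (N : TransComodule 𝒞) : TransComodule 𝒞 where
  obj x := contratensor (M.obj x) (N.obj x)
  map α := contratensor.map _ (M.map α) (N.map α)
  map_id x t := by
    let L : (contratensor (M.obj x) (N.obj x)).carrier →ₗ[K]
        (contratensor (M.obj x) (N.obj x)).carrier :=
      (linMap (contratensor.map _ (M.map (𝟙 x)) (N.map (𝟙 x))) :)
    have h : L = LinearMap.id := contratensor.linearMap_ext fun m n =>
      congrArg₂ (contratensor.tmul (M := M.obj x) (N := N.obj x)) (M.map_id x m) (N.map_id x n)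
    exact LinearMap.congr_fun h t
  map_comp {x y z} α β t := by
    let L {x y : X} (α : x ⟶ y) : (contratensor (M.obj y) (N.obj y)).carrier →ₗ[K]
        (contratensor (M.obj x) (N.obj x)).carrier :=
      (linMap (contratensor.map _ (M.map α) (N.map α)) :)
    have h : L (α ≫ β) = L α ∘ₗ L β := contratensor.linearMap_ext fun m n =>
      congrArg₂ (contratensor.tmul (M := M.obj x) (N := N.obj x))
        (M.map_comp α β m) (N.map_comp α β n)
    exact LinearMap.congr_fun h t

/-- The functor `M ↦ (M_x ⊠ N_x)_x`. -/
def contratensorFunctor (N : TransComodule 𝒞) : TransContramodule 𝒞 ⥤ TransComodule 𝒞 where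
  obj M := contratensorObj M N
  map {M M'} φ :=
    TransComodule.Hom.mk (M := contratensorObj M N) (N := contratensorObj M' N)
      (fun x => contratensor.mapLeft (app φ x) (N.obj x)) fun {x y} α =>
        contratensor.hom_ext fun m n =>
          congrArg
            (fun g : M.obj y ⟶ (RightContramodule.contrarestrict _).obj (M'.obj x) =>
              contratensor.tmul (M := M'.obj x) (N := N.obj x) (RightContramodule.linMap g m)
                (linMap (N.map α) n))
            (Hom.naturality φ α)
  map_id _ := TransComodule.hom_ext fun _ => contratensor.hom_ext fun _ _ => rfl
  map_comp _ _ := TransComodule.hom_ext fun _ => contratensor.hom_ext fun _ _ => rfl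

theorem isContratensorFunctor (N : TransComodule 𝒞) :
    IsContratensorFunctor N (contratensorFunctor N) where
  obj_eq _ _ := rfl
  map_eq M _ _ α := ⟨contratensor.map _ (M.map α) (N.map α), fun _ _ => rfl, rfl⟩
  hom_eq φ x := ⟨contratensor.mapLeft (app φ x) (N.obj x), fun _ _ => rfl, rfl⟩

end TransContramodule

namespace TransComodule.IsCartesian

variable [IsQuasiFiniteRep 𝒞] {N : TransComodule 𝒞}

theorem isIso_precomp (hN : N.IsCartesian) {x y : X} (α : x ⟶ y)
    (P : RightComodule K (𝒞.obj x)) : IsIso (comHom.precomp _ (N.map α) P) :=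
  have : IsIso (((shriekAdj (𝒞.map α).toCoalgHom).homEquiv _ _).symm (N.map α)) := hN α
  comHom.isIso_precomp _ (N.map α) P

/-- The morphism `Hom(N_y, P_y) → α_• Hom(N_x, P_x)` for `α : x → y`: composition with `P_α`,
followed by the inverse of precomposition with `N_α`. -/
noncomputable def comHomMap (hN : N.IsCartesian) (P : TransComodule 𝒞) {x y : X} (α : x ⟶ y) :
    comHom (N.obj y) (P.obj y) ⟶
      (RightContramodule.contrarestrict (𝒞.map α).toCoalgHom).obj (comHom (N.obj x) (P.obj x)) :=
  have := hN.isIso_precomp α (P.obj x)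
  comHom.postcomp (N.obj y) (P.map α) ≫ inv (comHom.precomp _ (N.map α) (P.obj x))

theorem comHomMap_comp_precomp (hN : N.IsCartesian) (P : TransComodule 𝒞) {x y : X} (α : x ⟶ y) :
    hN.comHomMap P α ≫ comHom.precomp _ (N.map α) (P.obj x) =
      comHom.postcomp (N.obj y) (P.map α) := by
  have := hN.isIso_precomp α (P.obj x)
  rw [comHomMap, Category.assoc, IsIso.inv_hom_id, Category.comp_id]

theorem comHomMap_comp_eq_iff (hN : N.IsCartesian) {P : TransComodule 𝒞} {x y : X} (α : x ⟶ y)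
    {M : RightContramodule K (𝒞.obj y)} (g : M ⟶ comHom (N.obj y) (P.obj y))
    (g' : M ⟶ (RightContramodule.contrarestrict (𝒞.map α).toCoalgHom).obj
      (comHom (N.obj x) (P.obj x))) :
    g ≫ hN.comHomMap P α = g' ↔
      g ≫ comHom.postcomp (N.obj y) (P.map α) = g' ≫ comHom.precomp _ (N.map α) (P.obj x) := by
  have := hN.isIso_precomp α (P.obj x)
  rw [← cancel_mono (comHom.precomp _ (N.map α) (P.obj x)), Category.assoc,
    comHomMap_comp_precomp]

theorem postcomp_comp_comHomMap (hN : N.IsCartesian) {P P' : TransComodule 𝒞} {x y : X} (α : x ⟶ y)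
    {f : P.obj x ⟶ P'.obj x} {g : P.obj y ⟶ P'.obj y}
    (h : g ≫ P'.map α = P.map α ≫ (corestrict _).map f) :
    comHom.postcomp (N.obj y) g ≫ hN.comHomMap P' α =
      hN.comHomMap P α ≫
        (RightContramodule.contrarestrict _).map (comHom.postcomp (N.obj x) f) := by
  rw [comHomMap_comp_eq_iff]
  calc comHom.postcomp (N.obj y) g ≫ comHom.postcomp (N.obj y) (P'.map α)
      = comHom.postcomp (N.obj y) (P.map α ≫ (corestrict _).map f) :=
        congrArg (comHom.postcomp (N.obj y)) h
    _ = (hN.comHomMap P α ≫ comHom.precomp _ (N.map α) (P.obj x)) ≫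
          comHom.postcomp (N.obj y) ((corestrict _).map f) := by
        rw [comHomMap_comp_precomp]
        rfl

theorem homEquiv_comp_comHomMap_eq_iff (hN : N.IsCartesian) (M : TransContramodule 𝒞)
    (P : TransComodule 𝒞) {x y : X} (α : x ⟶ y)
    (f : contratensor (M.obj x) (N.obj x) ⟶ P.obj x)
    (g : contratensor (M.obj y) (N.obj y) ⟶ P.obj y) :
    contratensor.homEquiv g ≫ hN.comHomMap P α =
        M.map α ≫ (RightContramodule.contrarestrict _).map (contratensor.homEquiv f) ↔
      g ≫ P.map α = contratensor.map _ (M.map α) (N.map α) ≫ (corestrict _).map f := by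
  rw [comHomMap_comp_eq_iff, Category.assoc, ← contratensor.homEquiv_naturality_right,
    ← contratensor.homEquiv_map_comp, contratensor.homEquiv.injective.eq_iff]

theorem map_comp_comHomMap_apply (hN : N.IsCartesian) (P : TransComodule 𝒞) {x y : X} (α : x ⟶ y)
    (φ : homs (N.obj y) (P.obj y)) :
    N.map α ≫ (corestrict _).map (ofHoms (RightContramodule.linMap (hN.comHomMap P α) φ)) =
      ofHoms φ ≫ P.map α :=
  congrArg (fun g : comHom (N.obj y) (P.obj y) ⟶ comHom (N.obj y) ((corestrict _).obj (P.obj x)) =>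
    ofHoms (RightContramodule.linMap g φ)) (hN.comHomMap_comp_precomp P α)

theorem comHomMap_apply_map_apply (hN : N.IsCartesian) (P : TransComodule 𝒞) {x y : X} (α : x ⟶ y)
    (φ : homs (N.obj y) (P.obj y)) (n : (N.obj y).carrier) :
    Subtype.val (p := (· ∈ homs (N.obj x) (P.obj x)))
      (RightContramodule.linMap (hN.comHomMap P α) φ) (linMap (N.map α) n) =
        linMap (P.map α) (φ.1 n) :=
  congrArg (fun g => linMap g n) (hN.map_comp_comHomMap_apply P α φ)

/-- The trans-contramodule `(Hom(N_x, P_x))_x`. -/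
noncomputable def comHomObj (hN : N.IsCartesian) (P : TransComodule 𝒞) : TransContramodule 𝒞 where
  obj x := comHom (N.obj x) (P.obj x)
  map α := hN.comHomMap P α
  map_id x φ :=
    let φ₀ : homs (N.obj x) (P.obj x) := φ
    hN.homs_ext (𝟙 x) (ψ := φ₀) fun n =>
      (hN.comHomMap_apply_map_apply P (𝟙 x) φ₀ n).trans <|
        (P.map_id x _).trans (congrArg φ₀.1 (N.map_id x n).symm)
  map_comp {x y z} α β φ :=
    let ψ : homs (N.obj y) (P.obj y) := RightContramodule.linMap (hN.comHomMap P β) φ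
    hN.homs_ext (α ≫ β) (ψ := RightContramodule.linMap (hN.comHomMap P α) ψ) fun n => by
      refine (hN.comHomMap_apply_map_apply P (α ≫ β) φ n).trans ((P.map_comp α β _).trans ?_)
      rw [N.map_comp α β n]
      exact (congrArg (linMap (P.map α)) (hN.comHomMap_apply_map_apply P β φ n)).symm.trans
        (hN.comHomMap_apply_map_apply P α ψ _).symm

/-- The functor `P ↦ (Hom(N_x, P_x))_x`. -/
noncomputable def comHomFunctor (hN : N.IsCartesian) :
    TransComodule 𝒞 ⥤ TransContramodule 𝒞 where
  obj P := hN.comHomObj P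
  map {P P'} ψ := TransContramodule.Hom.mk (M := hN.comHomObj P) (N := hN.comHomObj P')
    (fun x => comHom.postcomp (N.obj x) (app ψ x)) fun α =>
      hN.postcomp_comp_comHomMap α (Hom.naturality ψ α)
  map_id _ := TransContramodule.hom_ext fun _ => rfl
  map_comp _ _ := TransContramodule.hom_ext fun _ => rfl

theorem isComHomFunctor (hN : N.IsCartesian) : IsComHomFunctor N hN.comHomFunctor where
  obj_eq _ _ := rfl
  map_eq P _ _ α := ⟨hN.comHomMap P α, fun φ =>
    (((shriekAdj _).homEquiv_naturality_right_square_iff (ofHoms φ) (P.map α) (N.map α) _).2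
      (hN.map_comp_comHomMap_apply P α φ).symm).symm, rfl⟩
  hom_eq ψ x := ⟨comHom.postcomp (N.obj x) (app ψ x), fun _ => rfl, rfl⟩

/-- The adjunction between `M ↦ (M_x ⊠ N_x)_x` and `P ↦ (Hom(N_x, P_x))_x`. -/
noncomputable def contratensorAdj (hN : N.IsCartesian) :
    TransContramodule.contratensorFunctor N ⊣ hN.comHomFunctor :=
  Adjunction.mkOfHomEquiv
    { homEquiv := fun M P =>
        { toFun := fun f => TransContramodule.Hom.mk (M := M) (N := hN.comHomObj P)
            (fun x => contratensor.homEquiv (P := P.obj x) (app f x)) fun α =>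
              (hN.homEquiv_comp_comHomMap_eq_iff M P α _ _).2 (Hom.naturality f α)
          invFun := fun g => Hom.mk (M := M.contratensorObj N) (N := P)
            (fun x => contratensor.homEquiv.symm (TransContramodule.app g x)) fun α =>
              (hN.homEquiv_comp_comHomMap_eq_iff M P α _ _).1 (TransContramodule.Hom.naturality g α)
          left_inv := fun _ => hom_ext fun _ => contratensor.homEquiv.symm_apply_apply _
          right_inv := fun _ => rfl }
      homEquiv_naturality_left_symm := fun _ _ =>
        hom_ext fun _ => contratensor.hom_ext fun _ _ => rfl
      homEquiv_naturality_right := fun _ _ => rfl }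

end TransComodule.IsCartesian

end

theorem mainTheorem12 {K : Type u} [Field K] {X : Type w₁} [Category.{w₂} X]
    (𝒞 : X ⥤ CoalgCat.{u} K) [∀ x, Coalgebra.IsCocomm K (𝒞.obj x)] (N : TransComodule 𝒞) :
    ∃ F : TransContramodule 𝒞 ⥤ TransComodule 𝒞, IsContratensorFunctor N F ∧
      ∀ [IsQuasiFiniteRep 𝒞], N.IsCartesian →
        ∃ G : TransComodule 𝒞 ⥤ TransContramodule 𝒞, IsComHomFunctor N G ∧ Nonempty (F ⊣ G) :=
  ⟨TransContramodule.contratensorFunctor N, TransContramodule.isContratensorFunctor N,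
    fun hN => ⟨hN.comHomFunctor, hN.isComHomFunctor, ⟨hN.contratensorAdj⟩⟩⟩
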